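/- Let $(V,\omega)$ be a finite-dimensional real symplectic vector space and let $\Lambda\subset V$ be a lattice with $\omega(\Lambda\times\Lambda)\subset\mathbb Z$. Let $$\mathfrak S(V,\omega)=\{J\in\operatorname{End}V : J^2=-\mathrm{id},\ J^*\omega=\omega,\ \omega(\cdot,J\cdot)\text{ is positive definite}\}$$ be the Siegel space, on which $\operatorname{Sp}(V,\omega)$ acts by $a\cdot J=aJa^{-1}$. It carries the complex structure that on $T_J\mathfrak S(V,\omega)$ is $X\mapsto JX$, and the Siegel metric, which on $T_J\mathfrak S(V,\omega)$ is $\langle X,Y\rangle=\operatorname{tr}(XY)$. For $J\in\mathfrak S(V,\omega)$ and $z=x+iy\in\mathbb C^*$ put $\rho_J(z)=x\cdot\mathrm{id}+yJ\in\operatorname{GL}(V)$. The Hodge group $\operatorname{Hg}(J)$ is the smallest algebraic subgroup of $\operatorname{GL}(V)$ that is defined over $\mathbb Q$ (for the rational structure $\Lambda\otimes\mathbb Q$) and whose real points contain $\rho_J(S^1)$; its group of real points is denoted by $\operatorname{Hg}(J)$ as well. Then for every $J\in\mathfrak S(V,\omega)$: 1. $J\in\operatorname{Hg}(J)\cap\operatorname{Lie}\operatorname{Hg}(J)$.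 2. $\operatorname{Hg}(J)\subset\operatorname{Sp}(V,\omega)$, and $\operatorname{Hg}(J)$ is invariant under the Cartan involution $\theta_J(a)=JaJ^{-1}$ of $\operatorname{Sp}(V,\omega)$. 3. The stabilizer of $J$ in $\operatorname{Hg}(J)$ coincides with the centralizer of $J$ in $\operatorname{Hg}(J)$, and it is a maximal compact subgroup of $\operatorname{Hg}(J)$. 4. The orbit $\operatorname{Hg}(J)\cdot J\subset\mathfrak S(V,\omega)$ is a complex totally geodesic submanifold of $\mathfrak S(V,\omega)$. With the induced metric it is a Hermitian symmetric space of the non-compact type (that is, Hermitian symmetric, of nonpositive sectional curvature and without flat factor; it may be a point). -/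

import Mathlib

noncomputable section

namespace SiegelHodge

/-! ## Embedded submanifolds of a vector space and their geometry

Throughout this part `M` is a subset of a (finite-dimensional) real vector space `E`, and `B` is a
fixed bilinear form on `E`, not necessarily definite.  The metric of `M` is the restriction of `B`
to the tangent spaces of `M`; it is required to be positive definite there. -/

section Geometry

open scoped ContDiff Topology

variable {E : Type*} [NormedAddCommGroup E] [NormedSpace ℝ E]

/-- `M` is an embedded smooth submanifold of `E`: near each of its points, a diffeomorphism
between open subsets of `E` straightens `M` to a linear subspace. -/
def IsSmoothSubmanifold (M : Set E) : Prop :=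
  ∀ p ∈ M, ∃ (φ : OpenPartialHomeomorph E E) (W : Submodule ℝ E),
    p ∈ φ.source ∧ ContDiffOn ℝ ∞ φ φ.source ∧ ContDiffOn ℝ ∞ φ.symm φ.target ∧
      ∀ x ∈ φ.source, x ∈ M ↔ φ x ∈ W

/-- The tangent space `T_p M`: velocities at `p` of curves in `M` through `p`. -/
def tangentSpaceAt (M : Set E) (p : E) : Set E :=
  {v | ∃ γ : ℝ → E, γ 0 = p ∧ (∀ᶠ t in 𝓝 (0 : ℝ), γ t ∈ M) ∧ HasDerivAt γ v 0}

/-- `B` induces a Riemannian metric on the submanifold `M`. -/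
structure IsRiemannianSubmanifold (B : LinearMap.BilinForm ℝ E) (M : Set E) : Prop where
  smooth : IsSmoothSubmanifold M
  symm : ∀ u v, B u v = B v u
  pos : ∀ p ∈ M, ∀ v ∈ tangentSpaceAt M p, v ≠ 0 → 0 < B v v

/-- `t` is the tangential part at `p ∈ M` of the vector `a`, i.e. its `B`-orthogonal projection to
`T_p M`.  As `B` is constant on `E`, the Levi-Civita connection of `(M, B)` is the tangential part
of the ordinary derivative of `E`: if `Y` is tangent to `M` along a curve `γ` in `M`, then the
covariant derivative of `Y` along `γ` at time `t` is the tangential part of `Y' t` at `γ t`. -/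
def IsTangentialPart (B : LinearMap.BilinForm ℝ E) (M : Set E) (p a t : E) : Prop :=
  t ∈ tangentSpaceAt M p ∧ ∀ w ∈ tangentSpaceAt M p, B (a - t) w = 0

/-- `γ`, on the open interval `(a, b)`, is a geodesic of `(M, B)`: a smooth curve in `M` whose
velocity has covariant derivative zero. -/
def IsGeodesicOn (B : LinearMap.BilinForm ℝ E) (M : Set E) (γ : ℝ → E) (a b : ℝ) : Prop :=
  ContDiffOn ℝ ∞ γ (Set.Ioo a b) ∧ (∀ t ∈ Set.Ioo a b, γ t ∈ M) ∧
    ∀ t ∈ Set.Ioo a b, IsTangentialPart B M (γ t) (deriv (deriv γ) t) 0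

/-- `M` is a totally geodesic submanifold of `N`: every geodesic of `M`, for the metric induced
from `N`, is a geodesic of `N`. -/
structure IsTotallyGeodesicSubmanifold (B : LinearMap.BilinForm ℝ E) (M N : Set E) : Prop where
  subset : M ⊆ N
  riemannian : IsRiemannianSubmanifold B M
  riemannian_ambient : IsRiemannianSubmanifold B N
  geodesic : ∀ (γ : ℝ → E) (a b : ℝ), IsGeodesicOn B M γ a b → IsGeodesicOn B N γ a b

/-- The partial derivative in the first variable `x`. -/
def partialX (f : ℝ × ℝ → E) (z : ℝ × ℝ) : E := fderiv ℝ f z (1, 0)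

/-- The partial derivative in the second variable `y`. -/
def partialY (f : ℝ × ℝ → E) (z : ℝ × ℝ) : E := fderiv ℝ f z (0, 1)

/-- For a smooth map `f (x, y)` from `ℝ²` to `M`, the number `κ` is the value at the origin of
`⟨R(∂ₓf, ∂ᵧf) ∂ᵧf, ∂ₓf⟩ = ⟨∇ₓ ∇ᵧ ∂ᵧf - ∇ᵧ ∇ₓ ∂ᵧf, ∂ₓf⟩`, where `R` is the Riemann curvature tensor
of `(M, B)`; it has the sign of the sectional curvature of the plane spanned by `∂ₓf` and `∂ᵧf`.
Here `Ayy = ∇ᵧ ∂ᵧf` and `Axy = ∇ₓ ∂ᵧf`; in the last covariant derivatives the tangential part need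
not be taken, because they are paired with the tangent vector `∂ₓf`. -/
def IsCurvatureValue (B : LinearMap.BilinForm ℝ E) (M : Set E) (f : ℝ × ℝ → E) (κ : ℝ) : Prop :=
  ContDiff ℝ ∞ f ∧ (∀ z, f z ∈ M) ∧
    ∃ Ayy Axy : ℝ × ℝ → E, ContDiff ℝ ∞ Ayy ∧ ContDiff ℝ ∞ Axy ∧
      (∀ z, IsTangentialPart B M (f z) (partialY (partialY f) z) (Ayy z)) ∧
      (∀ z, IsTangentialPart B M (f z) (partialX (partialY f) z) (Axy z)) ∧
      κ = B (partialX Ayy 0 - partialY Axy 0) (partialX f 0)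

/-- `M` is a complex manifold, with the complex structure given by `v ↦ 𝒥 p v` on `T_p M`: the
tangent spaces are stable, and near each point there are holomorphic coordinates, i.e. a smooth map
to `ℂᵏ` whose differential restricts to `ℂ`-linear bijections from the tangent spaces of `M`. -/
structure IsComplexManifold (𝒥 : E → E → E) (M : Set E) : Prop where
  smooth : IsSmoothSubmanifold M
  stable : ∀ p ∈ M, ∀ v ∈ tangentSpaceAt M p, 𝒥 p v ∈ tangentSpaceAt M p
  coordinates : ∀ p ∈ M, ∃ (k : ℕ) (φ : E → (Fin k → ℂ)) (U : Set E), IsOpen U ∧ p ∈ U ∧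
    ContDiffOn ℝ ∞ φ U ∧ ∀ x ∈ M ∩ U,
      Set.BijOn (fderiv ℝ φ x) (tangentSpaceAt M x) Set.univ ∧
      ∀ v ∈ tangentSpaceAt M x, fderiv ℝ φ x (𝒥 x v) = Complex.I • fderiv ℝ φ x v

/-- `M` is a complex submanifold of `N`: both are complex manifolds, for the same complex structure
on tangent vectors, so that the inclusion is holomorphic. -/
structure IsComplexSubmanifold (𝒥 : E → E → E) (M N : Set E) : Prop where
  subset : M ⊆ N
  complex : IsComplexManifold 𝒥 M
  complex_ambient : IsComplexManifold 𝒥 N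

/-- `s` restricts to a holomorphic isometry of `M` onto itself. -/
structure IsHolomorphicIsometry (𝒥 : E → E → E) (B : LinearMap.BilinForm ℝ E) (M : Set E)
    (s : E → E) : Prop where
  bijOn : Set.BijOn s M M
  smooth : ∀ x ∈ M, ContDiffAt ℝ ∞ s x
  isometry : ∀ x ∈ M, ∀ u ∈ tangentSpaceAt M x, ∀ v ∈ tangentSpaceAt M x,
    B (fderiv ℝ s x u) (fderiv ℝ s x v) = B u v
  holomorphic : ∀ x ∈ M, ∀ v ∈ tangentSpaceAt M x, fderiv ℝ s x (𝒥 x v) = 𝒥 (s x) (fderiv ℝ s x v)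

/-- `M` is a Hermitian symmetric space: a connected complex manifold with a Hermitian metric, each
point of which is an isolated fixed point of an involutive holomorphic isometry. -/
structure IsHermitianSymmetricSpace (𝒥 : E → E → E) (B : LinearMap.BilinForm ℝ E) (M : Set E) :
    Prop where
  connected : IsConnected M
  complex : IsComplexManifold 𝒥 M
  riemannian : IsRiemannianSubmanifold B M
  hermitian : ∀ p ∈ M, ∀ u ∈ tangentSpaceAt M p, ∀ v ∈ tangentSpaceAt M p,
    B (𝒥 p u) (𝒥 p v) = B u v
  symmetry : ∀ p ∈ M, ∃ s : E → E, IsHolomorphicIsometry 𝒥 B M s ∧ (∀ x ∈ M, s (s x) = x) ∧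
    s p = p ∧ ∀ᶠ x in 𝓝[M] p, s x = x → x = p

/-- A Hermitian symmetric space of the non-compact type: the sectional curvature is nonpositive and
there is no flat factor, i.e. each nonzero tangent vector lies in a plane of negative sectional
curvature.  (A point is allowed: it has no compact and no flat factor.) -/
structure IsHermitianSymmetricSpaceOfNoncompactType (𝒥 : E → E → E) (B : LinearMap.BilinForm ℝ E)
    (M : Set E) : Prop where
  hermitianSymmetric : IsHermitianSymmetricSpace 𝒥 B M
  nonpos : ∀ (f : ℝ × ℝ → E) (κ : ℝ), IsCurvatureValue B M f κ → κ ≤ 0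
  no_flat : ∀ p ∈ M, ∀ u ∈ tangentSpaceAt M p, u ≠ 0 →
    ∃ (f : ℝ × ℝ → E) (κ : ℝ), IsCurvatureValue B M f κ ∧ f 0 = p ∧ partialX f 0 = u ∧ κ < 0

end Geometry

/-! ## Siegel space -/

section Siegel

variable {V : Type*} [NormedAddCommGroup V] [NormedSpace ℝ V]

/-- The Siegel space `𝔖(V, ω)`: complex structures `J` on `V` with `J^* ω = ω` and
`g_J = ω(·, J·)` positive definite (the symmetry of `g_J` is automatic). -/
def siegelSpace (ω : LinearMap.BilinForm ℝ V) : Set (V →L[ℝ] V) :=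
  {J | J * J = -1 ∧ (∀ u v, ω (J u) (J v) = ω u v) ∧ ∀ v, v ≠ 0 → 0 < ω v (J v)}

/-- The trace form `tr (X Y)` on `End V`.  On the tangent space of the Siegel space at `J`, which
consists of the `X ∈ 𝔰𝔭(V, ω)` with `X J = - J X`, it is the Siegel metric: up to a constant
factor, the symmetric Riemannian metric invariant under `Sp(V, ω)`. -/
def siegelForm (V : Type*) [NormedAddCommGroup V] [NormedSpace ℝ V] :
    LinearMap.BilinForm ℝ (V →L[ℝ] V) :=
  LinearMap.mk₂ ℝ (fun X Y => LinearMap.trace ℝ V ((X * Y : V →L[ℝ] V) : V →ₗ[ℝ] V))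
    (fun X X' Y => by rw [add_mul, ContinuousLinearMap.toLinearMap_add, map_add])
    (fun c X Y => by rw [smul_mul_assoc, ContinuousLinearMap.toLinearMap_smul, map_smul])
    (fun X Y Y' => by rw [mul_add, ContinuousLinearMap.toLinearMap_add, map_add])
    (fun c X Y => by rw [mul_smul_comm, ContinuousLinearMap.toLinearMap_smul, map_smul])

/-- The complex structure of the Siegel space: multiplication by `i` on the tangent space at `J`
is `X ↦ J X`. -/
def siegelComplexStructure (J X : V →L[ℝ] V) : V →L[ℝ] V := J * X

/-- A complex structure on `V` as an element of `GL(V)`. -/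
def complexStructureUnit (J : V →L[ℝ] V) (h : J * J = -1) : (V →L[ℝ] V)ˣ where
  val := J
  inv := -J
  val_inv := by rw [mul_neg, h, neg_neg]
  inv_val := by rw [neg_mul, h, neg_neg]

/-- The symplectic group `Sp(V, ω)`. -/
def symplecticGroup (ω : LinearMap.BilinForm ℝ V) : Subgroup (V →L[ℝ] V)ˣ where
  carrier := {a | ∀ u v, ω ((a : V →L[ℝ] V) u) ((a : V →L[ℝ] V) v) = ω u v}
  one_mem' := fun _ _ => rfl
  mul_mem' := by
    intro a b ha hb u v
    rw [Units.val_mul, mul_apply_eq_comp, mul_apply_eq_comp, ha, hb]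
  inv_mem' := by
    intro a ha u v
    have h : ∀ x, (a : V →L[ℝ] V) (((a⁻¹ : (V →L[ℝ] V)ˣ) : V →L[ℝ] V) x) = x := fun x => by
      rw [← mul_apply_eq_comp, Units.mul_inv, one_apply_eq_self]
    rw [← ha, h, h]

/-- The action `a • J = a J a⁻¹` of `GL(V)` on `End V`. -/
def conjAction (a : (V →L[ℝ] V)ˣ) (J : V →L[ℝ] V) : V →L[ℝ] V :=
  a * J * ((a⁻¹ : (V →L[ℝ] V)ˣ) : V →L[ℝ] V)

/-- The orbit `G • J`. -/
def orbit (G : Subgroup (V →L[ℝ] V)ˣ) (J : V →L[ℝ] V) : Set (V →L[ℝ] V) :=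
  {x | ∃ a ∈ G, conjAction a J = x}

/-- The stabilizer of `J` in `G` for the action `a • J = a J a⁻¹`. -/
def stabilizerIn (G : Subgroup (V →L[ℝ] V)ˣ) (J : V →L[ℝ] V) : Subgroup (V →L[ℝ] V)ˣ where
  carrier := {a | a ∈ G ∧ conjAction a J = J}
  one_mem' := ⟨G.one_mem, by simp [conjAction]⟩
  mul_mem' := by
    rintro a b ⟨ha, ha'⟩ ⟨hb, hb'⟩
    refine ⟨G.mul_mem ha hb, ?_⟩
    calc conjAction (a * b) J = conjAction a (conjAction b J) := by
          simp only [conjAction, mul_inv_rev, Units.val_mul, mul_assoc]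
      _ = J := by rw [hb', ha']
  inv_mem' := by
    rintro a ⟨ha, ha'⟩
    refine ⟨G.inv_mem ha, ?_⟩
    calc conjAction a⁻¹ J = conjAction a⁻¹ (conjAction a J) := by rw [ha']
      _ = J := by simp [conjAction, mul_assoc]

/-- The Lie algebra of a closed linear group: the `X` whose one-parameter group lies in `G`. -/
def lieAlgebraOf (G : Subgroup (V →L[ℝ] V)ˣ) : Set (V →L[ℝ] V) :=
  {X | ∀ t : ℝ, ∃ a ∈ G, (a : V →L[ℝ] V) = NormedSpace.exp (t • X)}

/-- `K` is a maximal compact subgroup of `G`. -/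
def IsMaximalCompactSubgroup (K G : Subgroup (V →L[ℝ] V)ˣ) : Prop :=
  K ≤ G ∧ IsCompact (K : Set (V →L[ℝ] V)ˣ) ∧
    ∀ K' : Subgroup (V →L[ℝ] V)ˣ, K' ≤ G → IsCompact (K' : Set (V →L[ℝ] V)ˣ) → K ≤ K' → K' = K

/-! ## The Hodge group -/

/-- The representation `ρ_J` of `ℂ^*`: the real operator whose complexification is `z` on
`H^{1,0}` (the `i`-eigenspace of `J` in `V ⊗ ℂ`) and `conj z` on `H^{0,1}` (the `-i`-eigenspace). -/
def rho (J : V →L[ℝ] V) (z : ℂ) : V →L[ℝ] V := z.re • (1 : V →L[ℝ] V) + z.im • J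

/-- `H ⊆ GL(V)` is the group of real points of an algebraic subgroup of `GL(V)` defined over `ℚ`,
for the rational structure `Λ ⊗ ℚ` of `V`.  In a basis of the lattice `Λ`, the algebraic subgroup
is given by a set `P` of polynomials with rational coefficients in the matrix entries, whose common
zeros in `GL_n(ℂ)` form a subgroup; `H` is the set of its real points. -/
def IsRealPointsOfRationalGroup (Λ : Submodule ℤ V) (H : Subgroup (V →L[ℝ] V)ˣ) : Prop :=
  ∃ (n : ℕ) (b : Module.Basis (Fin n) ℝ V) (P : Set (MvPolynomial (Fin n × Fin n) ℚ)),
    Submodule.span ℤ (Set.range b) = Λ ∧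
    (∃ Hc : Subgroup (Matrix.GeneralLinearGroup (Fin n) ℂ), ∀ g, g ∈ Hc ↔
      ∀ q ∈ P, MvPolynomial.aeval
        (fun ij : Fin n × Fin n => (g : Matrix (Fin n) (Fin n) ℂ) ij.1 ij.2) q = 0) ∧
    ∀ a, a ∈ H ↔ ∀ q ∈ P, MvPolynomial.aeval
      (fun ij : Fin n × Fin n =>
        LinearMap.toMatrix b b ((a : V →L[ℝ] V) : V →ₗ[ℝ] V) ij.1 ij.2) q = 0

/-- The (real points of the) Hodge group `Hg(J)`: the smallest algebraic subgroup of `GL(V)`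
defined over `ℚ` whose real points contain `ρ_J(S¹)`.  The intersection of all such algebraic
subgroups is one of them, and its real points are the intersection of their real points. -/
def hodgeGroup (Λ : Submodule ℤ V) (J : V →L[ℝ] V) : Subgroup (V →L[ℝ] V)ˣ :=
  sInf {H | IsRealPointsOfRationalGroup Λ H ∧
    ∀ z : ℂ, ‖z‖ = 1 → ∃ a ∈ H, (a : V →L[ℝ] V) = rho J z}

end Siegel

end SiegelHodge

end

open SiegelHodge

/-!
The Hodge group `G = Hg(J)` is studied through three properties, collected in `IsPolarGroup` and
`IsBasePoint`: it is a closed subgroup of `Sp(V, ω)`, it contains all real powers of its positive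
definite elements, and `J` belongs to its Lie algebra.

The first holds because `Sp(V, ω)` is itself defined over `ℚ`, the form being integral on the
lattice.  For the second, let `exp X` be a real diagonalizable element of a group `H` given by
polynomial equations.  The value of such a polynomial at `exp (t X)` is an exponential polynomial
in `t` that vanishes at the natural numbers, hence is zero by the linear independence of characters
(`aeval_exp_smul_eq_zero`).  The third is the formula `exp (t J) = ρ_J(e^{it})`; it also gives
`J ∈ G`, so that `G` is stable under the Cartan involution at `J`, which is conjugation by `J`.

The Cartan decomposition then takes the form `G • J = exp(𝔭) J`, where `𝔭` is the part of the Lie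
algebra `𝔤` that anticommutes with `J` (`IsBasePoint.mem_orbit_iff`): for `y = a J a⁻¹`, the operator
`- y J` lies in `G` and is positive definite for `g_J`, and its logarithm lies in `𝔭`.  The
maximality of the compact group `K = Stab(J)` follows, since a larger group would contain some
`exp Y ≠ 1` with `Y ∈ 𝔭`, whose powers are unbounded.

All the points `y` of the orbit `M = G • J` are equally good base points and lie in `G`, whence the
uniform description `T_y M = {X ∈ 𝔤 | X y = - y X}` (`tangentSpaceAt_orbit`), and the orthogonal
projection of `X ∈ 𝔤` to `T_y M` is `(X + y X y) / 2` (`isTangentialPart_orbit`).  This formula is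
the same for `Sp(V, ω)`, whose orbit is the whole Siegel space, and the acceleration of a curve in
`M` lies in `𝔤`; so `M` is totally geodesic.  Differentiating the formula gives the curvature
`⟨R(U, W) W, U⟩ = ¼ tr [U, W]²` (`curvatureValue_eq`).  It is nonpositive because `[U, W]` is
skew-symmetric for `g_y`, and equals `- tr U⁴ < 0` for `W = y U`.

Near `J`, the inverse of `Y ↦ exp Y · J` straightens `M` to `𝔭`.  Holomorphic coordinates come from
the Cayley transform `y ↦ (J - y)(J + y)⁻¹`, whose differential at `y` is
`X ↦ -2 J S⁻¹ X S⁻¹` with `S = J + y`.  As `S J = y S`, it intertwines multiplication by `y` with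
multiplication by `J`, and it maps `T_y M` onto `𝔭` (`IsBasePoint.sandwich_mem_tangent`).  The
symmetry at `y` is conjugation by `y ∈ G`.
-/

set_option linter.unusedSectionVars false

noncomputable section

namespace SiegelHodge

open scoped Topology
open Filter Module

/-! ### Self-adjoint operators for a positive definite form -/

section InnerProduct

variable {W : Type*} [AddCommGroup W] [Module ℝ W] [FiniteDimensional ℝ W]
  (g : LinearMap.BilinForm ℝ W)

/-- The spectral theorem for a symmetric operator with respect to a positive definite form that is
not registered as the inner product of the space. -/
theorem exists_orthonormal_eigenbasis (hs : ∀ u v, g u v = g v u) (hp : ∀ v, v ≠ 0 → 0 < g v v)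
    (T : W →ₗ[ℝ] W) (hT : ∀ u v, g (T u) v = g u (T v)) :
    ∃ (b : Basis (Fin (finrank ℝ W)) ℝ W) (μ : Fin (finrank ℝ W) → ℝ),
      (∀ i j, g (b i) (b j) = if i = j then 1 else 0) ∧ ∀ i, T (b i) = μ i • b i := by
  let core : InnerProductSpace.Core ℝ W :=
    { inner := fun u v => g u v
      conj_inner_symm := fun u v => by simpa using hs v u
      re_inner_nonneg := fun v => by
        rcases eq_or_ne v 0 with rfl | h
        · simp
        · simpa using (hp v h).le
      add_left := fun u v w => by simp
      smul_left := fun u v r => by simp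
      definite := fun v h => by
        by_contra hv
        exact (hp v hv).ne' h }
  let _ : NormedAddCommGroup W := core.toNormedAddCommGroup
  let _ : InnerProductSpace ℝ W := InnerProductSpace.ofCore core.toCore
  have hsym : T.IsSymmetric := fun u v => hT u v
  refine ⟨(hsym.eigenvectorBasis rfl).toBasis, hsym.eigenvalues rfl, fun i j => ?_, fun i => ?_⟩
  · have := orthonormal_iff_ite.1 (hsym.eigenvectorBasis rfl).orthonormal i j
    rw [OrthonormalBasis.coe_toBasis]
    exact this
  · rw [OrthonormalBasis.coe_toBasis]
    exact hsym.apply_eigenvectorBasis rfl i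

theorem exists_orthonormal_basis (hs : ∀ u v, g u v = g v u) (hp : ∀ v, v ≠ 0 → 0 < g v v) :
    ∃ b : Basis (Fin (finrank ℝ W)) ℝ W, ∀ i j, g (b i) (b j) = if i = j then 1 else 0 := by
  obtain ⟨b, -, hb, -⟩ := exists_orthonormal_eigenbasis g hs hp 0 (by simp)
  exact ⟨b, hb⟩

variable {g}

theorem repr_eq_of_orthonormal {ι : Type*} [Fintype ι] [DecidableEq ι] (b : Basis ι ℝ W)
    (hb : ∀ i j, g (b i) (b j) = if i = j then 1 else 0) (v : W) (i : ι) :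
    b.repr v i = g (b i) v := by
  conv_rhs => rw [← b.sum_repr v]
  simp only [map_sum, map_smul, hb, smul_eq_mul, mul_ite, mul_one, mul_zero]
  simp

theorem trace_eq_sum_of_orthonormal {ι : Type*} [Fintype ι] [DecidableEq ι] (b : Basis ι ℝ W)
    (hb : ∀ i j, g (b i) (b j) = if i = j then 1 else 0) (T : W →ₗ[ℝ] W) :
    LinearMap.trace ℝ W T = ∑ i, g (b i) (T (b i)) := by
  rw [LinearMap.trace_eq_matrix_trace ℝ b, Matrix.trace]
  simp [LinearMap.toMatrix_apply, repr_eq_of_orthonormal b hb]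

variable (g)

theorem trace_mul_self_pos (hs : ∀ u v, g u v = g v u) (hp : ∀ v, v ≠ 0 → 0 < g v v)
    (T : W →ₗ[ℝ] W) (hT : ∀ u v, g (T u) v = g u (T v)) (h0 : T ≠ 0) :
    0 < LinearMap.trace ℝ W (T * T) := by
  obtain ⟨b, hb⟩ := exists_orthonormal_basis g hs hp
  rw [trace_eq_sum_of_orthonormal b hb]
  have hnn : ∀ v, 0 ≤ g v v := fun v => by
    rcases eq_or_ne v 0 with rfl | h
    · simp
    · exact (hp v h).le
  obtain ⟨i, hi⟩ : ∃ i, T (b i) ≠ 0 := by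
    by_contra! h
    exact h0 (b.ext fun i => by simp [h i])
  refine Finset.sum_pos' (fun i _ => ?_) ⟨i, Finset.mem_univ _, ?_⟩
  · rw [End.mul_apply, ← hT]; exact hnn _
  · rw [End.mul_apply, ← hT]; exact hp _ hi

theorem trace_mul_self_nonpos (hs : ∀ u v, g u v = g v u) (hp : ∀ v, v ≠ 0 → 0 < g v v)
    (T : W →ₗ[ℝ] W) (hT : ∀ u v, g (T u) v = - g u (T v)) :
    LinearMap.trace ℝ W (T * T) ≤ 0 := by
  obtain ⟨b, hb⟩ := exists_orthonormal_basis g hs hp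
  rw [trace_eq_sum_of_orthonormal b hb]
  refine Finset.sum_nonpos fun i _ => ?_
  rw [End.mul_apply, ← neg_neg (g (b i) _), ← hT, neg_nonpos]
  rcases eq_or_ne (T (b i)) 0 with h | h
  · simp [h]
  · exact (hp _ h).le

end InnerProduct

section Norm

variable {W : Type*} [NormedAddCommGroup W] [NormedSpace ℝ W] [FiniteDimensional ℝ W]
  (g : LinearMap.BilinForm ℝ W)

/-- A positive definite form on a finite-dimensional space is coercive. -/
theorem exists_norm_sq_le (hs : ∀ u v, g u v = g v u) (hp : ∀ v, v ≠ 0 → 0 < g v v) :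
    ∃ C : ℝ, 0 ≤ C ∧ ∀ v, ‖v‖ ^ 2 ≤ C * g v v := by
  obtain ⟨b, hb⟩ := exists_orthonormal_basis g hs hp
  refine ⟨(∑ i, ‖b i‖) ^ 2, by positivity, fun v => ?_⟩
  have hexp : g v v = ∑ i, b.repr v i ^ 2 := by
    conv_lhs => rw [← b.sum_repr v]
    simp only [map_sum, map_smul, LinearMap.sum_apply, LinearMap.smul_apply, hb, smul_eq_mul,
      mul_ite, mul_one, mul_zero]
    simp [sq]
  have hnn : 0 ≤ g v v := by rw [hexp]; positivity
  have hle : ‖v‖ ≤ (∑ i, ‖b i‖) * √(g v v) := by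
    conv_lhs => rw [← b.sum_repr v]
    rw [Finset.sum_mul]
    refine (norm_sum_le _ _).trans (Finset.sum_le_sum fun i _ => ?_)
    rw [norm_smul, mul_comm]
    refine mul_le_mul_of_nonneg_left ?_ (norm_nonneg _)
    rw [Real.norm_eq_abs]
    refine Real.abs_le_sqrt ?_
    rw [hexp]
    exact Finset.single_le_sum (f := fun i => b.repr v i ^ 2) (fun i _ => sq_nonneg _)
      (Finset.mem_univ i)
  calc ‖v‖ ^ 2 ≤ ((∑ i, ‖b i‖) * √(g v v)) ^ 2 := by gcongr
    _ = _ := by rw [mul_pow, Real.sq_sqrt hnn]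

end Norm

/-! ### Exponentials of real diagonalizable operators -/

section Exp

variable {V : Type*} [NormedAddCommGroup V] [NormedSpace ℝ V] [FiniteDimensional ℝ V]

instance : CompleteSpace (V →L[ℝ] V) := FiniteDimensional.complete ℝ _

/-- The functional equation of the exponential is available in algebras over `ℚ`. -/
instance : NormedAlgebra ℚ (V →L[ℝ] V) := NormedAlgebra.restrictScalars ℚ ℝ _

/-- `X` is diagonalizable over the real numbers. -/
def IsRealDiagonalizable (X : V →L[ℝ] V) : Prop :=
  ∃ (b : Basis (Fin (finrank ℝ V)) ℝ V) (μ : Fin (finrank ℝ V) → ℝ), ∀ i, X (b i) = μ i • b i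

theorem exp_apply_of_eigenvector {X : V →L[ℝ] V} {v : V} {μ : ℝ} (h : X v = μ • v) :
    NormedSpace.exp X v = Real.exp μ • v := by
  have h1 : HasSum (fun n : ℕ => ((n.factorial : ℝ)⁻¹ • X ^ n) v) (NormedSpace.exp X v) :=
    (NormedSpace.exp_series_hasSum_exp' (𝕂 := ℝ) X).mapL (ContinuousLinearMap.apply ℝ V v)
  have hpow : ∀ n : ℕ, (X ^ n) v = μ ^ n • v := fun n => by
    induction n with
    | zero => simp
    | succ n ih => rw [pow_succ', mul_apply_eq_comp, ih, map_smul, h, smul_smul,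
        pow_succ]
  have h2 : HasSum (fun n : ℕ => ((n.factorial : ℝ)⁻¹ • X ^ n) v) (Real.exp μ • v) := by
    have := (NormedSpace.exp_series_hasSum_exp' (𝕂 := ℝ) μ).smul_const v
    rw [← Real.exp_eq_exp_ℝ] at this
    convert this using 2 with n
    simp [hpow, smul_smul]
  exact h1.unique h2

theorem exp_add_smul (X : V →L[ℝ] V) (s t : ℝ) :
    NormedSpace.exp ((s + t) • X) = NormedSpace.exp (s • X) * NormedSpace.exp (t • X) := by
  rw [add_smul, NormedSpace.exp_add_of_commute]
  exact ((Commute.refl X).smul_left s).smul_right t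

theorem exp_mul_exp_neg (X : V →L[ℝ] V) : NormedSpace.exp X * NormedSpace.exp (-X) = 1 := by
  rw [← NormedSpace.exp_add_of_commute (Commute.refl X).neg_right, add_neg_cancel,
    NormedSpace.exp_zero]

theorem exp_neg_mul_exp (X : V →L[ℝ] V) : NormedSpace.exp (-X) * NormedSpace.exp X = 1 := by
  simpa using exp_mul_exp_neg (-X)

/-- `exp X` as an element of `GL(V)`. -/
def expUnit (X : V →L[ℝ] V) : (V →L[ℝ] V)ˣ :=
  ⟨NormedSpace.exp X, NormedSpace.exp (-X), exp_mul_exp_neg X, exp_neg_mul_exp X⟩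

@[simp] theorem coe_expUnit (X : V →L[ℝ] V) : (expUnit X : V →L[ℝ] V) = NormedSpace.exp X := rfl

@[simp] theorem coe_expUnit_inv (X : V →L[ℝ] V) :
    (((expUnit X)⁻¹ : (V →L[ℝ] V)ˣ) : V →L[ℝ] V) = NormedSpace.exp (-X) := rfl

theorem mem_lieAlgebraOf_iff {G : Subgroup (V →L[ℝ] V)ˣ} {X : V →L[ℝ] V} :
    X ∈ lieAlgebraOf G ↔ ∀ t : ℝ, expUnit (t • X) ∈ G := by
  refine forall_congr' fun t => ⟨?_, fun h => ⟨_, h, rfl⟩⟩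
  rintro ⟨a, ha, h⟩
  rwa [show expUnit (t • X) = a from Units.ext h.symm]

/-- The exponential is injective on real diagonalizable operators. -/
theorem IsRealDiagonalizable.exp_injective {X Y : V →L[ℝ] V} (hX : IsRealDiagonalizable X)
    (hY : IsRealDiagonalizable Y) (h : NormedSpace.exp X = NormedSpace.exp Y) : X = Y := by
  obtain ⟨b, μ, hb⟩ := hX
  obtain ⟨c, ν, hc⟩ := hY
  refine ContinuousLinearMap.coe_injective (c.ext fun j => ?_)
  -- comparing the coordinates of `exp X (c j) = exp Y (c j)` in the eigenbasis of `X`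
  have h1 : ∀ i, b.repr (c j) i * Real.exp (μ i) = Real.exp (ν j) * b.repr (c j) i := by
    intro i
    have h2 : NormedSpace.exp X (c j) = Real.exp (ν j) • c j := by
      rw [h, exp_apply_of_eigenvector (hc j)]
    have h3 : NormedSpace.exp X (c j) = ∑ i, (b.repr (c j) i * Real.exp (μ i)) • b i := by
      conv_lhs => rw [← b.sum_repr (c j)]
      simp only [map_sum, map_smul, exp_apply_of_eigenvector (hb _), smul_smul]
    have h4 := congrArg (fun v => b.repr v i) (h3.symm.trans h2)
    simpa [Finsupp.single_apply] using h4
  have h5 : X (c j) = ν j • c j := by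
    conv_lhs => rw [← b.sum_repr (c j)]
    conv_rhs => rw [← b.sum_repr (c j)]
    rw [map_sum, Finset.smul_sum]
    refine Finset.sum_congr rfl fun i _ => ?_
    rw [map_smul, hb, smul_smul, smul_smul]
    rcases eq_or_ne (b.repr (c j) i) 0 with h0 | h0
    · simp [h0]
    · have : Real.exp (μ i) = Real.exp (ν j) :=
        mul_left_cancel₀ h0 ((h1 i).trans (mul_comm _ _))
      rw [Real.exp_injective this, mul_comm]
  simp [h5, hc]

end Exp

/-! ### The Lie algebra of a closed linear group -/

section Lie

variable {V : Type*} [NormedAddCommGroup V] [NormedSpace ℝ V] [FiniteDimensional ℝ V]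

theorem mem_of_tendsto_val {G : Subgroup (V →L[ℝ] V)ˣ} (hG : IsClosed (G : Set (V →L[ℝ] V)ˣ))
    {u : ℕ → (V →L[ℝ] V)ˣ} {a : (V →L[ℝ] V)ˣ} (hu : ∀ᶠ n in atTop, u n ∈ G)
    (h : Tendsto (fun n => (u n : V →L[ℝ] V)) atTop (𝓝 (a : V →L[ℝ] V))) : a ∈ G :=
  hG.mem_of_tendsto (Units.isOpenEmbedding_val.tendsto_nhds_iff.2 h) hu

/-- A velocity at `1` of a curve in a closed linear group `G` belongs to the Lie algebra of `G`:
if `γ = exp ∘ h` near `0`, then `γ (t / n) ^ n = exp (n h (t / n))` tends to `exp (t γ'(0))`. -/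
theorem mem_lieAlgebraOf_of_hasDerivAt {G : Subgroup (V →L[ℝ] V)ˣ}
    (hG : IsClosed (G : Set (V →L[ℝ] V)ˣ)) {γ : ℝ → V →L[ℝ] V} {X : V →L[ℝ] V} (h0 : γ 0 = 1)
    (hγ : ∀ᶠ t in 𝓝 (0 : ℝ), ∃ a ∈ G, (a : V →L[ℝ] V) = γ t) (hd : HasDerivAt γ X 0) :
    X ∈ lieAlgebraOf G := by
  have hexp : HasStrictFDerivAt (NormedSpace.exp : (V →L[ℝ] V) → V →L[ℝ] V)
      ((ContinuousLinearEquiv.refl ℝ (V →L[ℝ] V) : (V →L[ℝ] V) ≃L[ℝ] (V →L[ℝ] V)) :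
        (V →L[ℝ] V) →L[ℝ] V →L[ℝ] V) 0 := hasStrictFDerivAt_exp_zero
  set L := hexp.localInverse _ _ _ with hL
  have hL1 : L 1 = 0 := by
    have := hexp.localInverse_apply_image
    rwa [NormedSpace.exp_zero] at this
  have hLd : HasFDerivAt L (ContinuousLinearMap.id ℝ (V →L[ℝ] V)) (γ 0) := by
    have := hexp.to_localInverse.hasFDerivAt
    rw [NormedSpace.exp_zero] at this
    rw [h0]
    exact this
  have hLr : ∀ᶠ t in 𝓝 (0 : ℝ), NormedSpace.exp (L (γ t)) = γ t := by
    have := hexp.eventually_right_inverse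
    rw [NormedSpace.exp_zero, ← h0] at this
    exact hd.continuousAt.eventually this
  refine mem_lieAlgebraOf_iff.2 fun t => ?_
  have hlin : HasDerivAt (fun s : ℝ => s * t) t 0 := by
    simpa using (hasDerivAt_id (0 : ℝ)).mul_const t
  have hLγ : HasDerivAt (fun s : ℝ => L (γ (s * t))) (t • X) 0 := by
    have h1 : HasDerivAt (fun s => L (γ s)) X ((0 : ℝ) * t) := by
      rw [zero_mul]
      exact hLd.comp_hasDerivAt (0 : ℝ) hd
    exact h1.scomp (0 : ℝ) hlin
  have hseq : Tendsto (fun n : ℕ => ((n : ℝ)⁻¹)) atTop (𝓝[>] 0) :=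
    tendsto_inv_atTop_nhdsGT_zero.comp tendsto_natCast_atTop_atTop
  have hseq0 : Tendsto (fun n : ℕ => ((n : ℝ)⁻¹ * t)) atTop (𝓝 0) := by
    simpa using (hseq.mono_right nhdsWithin_le_nhds).mul_const t
  have hlim : Tendsto (fun n : ℕ => (n : ℝ) • L (γ ((n : ℝ)⁻¹ * t))) atTop (𝓝 (t • X)) := by
    have := hLγ.tendsto_slope_zero_right.comp hseq
    refine this.congr fun n => ?_
    simp [h0, hL1]
  have hlim2 : Tendsto (fun n : ℕ => (expUnit ((n : ℝ) • L (γ ((n : ℝ)⁻¹ * t))) : V →L[ℝ] V))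
      atTop (𝓝 (expUnit (t • X) : V →L[ℝ] V)) :=
    (NormedSpace.exp_continuous.tendsto _).comp hlim
  refine mem_of_tendsto_val hG ?_ hlim2
  filter_upwards [hseq0.eventually hLr, hseq0.eventually hγ] with n h1 h2
  obtain ⟨a, ha, h2⟩ := h2
  have : expUnit ((n : ℝ) • L (γ ((n : ℝ)⁻¹ * t))) = a ^ n := by
    ext1
    rw [coe_expUnit, Nat.cast_smul_eq_nsmul, NormedSpace.exp_nsmul, h1, Units.val_pow_eq_pow_val,
      h2]
  rw [this]
  exact pow_mem ha n

theorem hasDerivAt_exp_smul (X : V →L[ℝ] V) :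
    HasDerivAt (fun t : ℝ => NormedSpace.exp (t • X)) X 0 := by
  simpa using hasDerivAt_exp_smul_const (𝕂 := ℝ) X 0

theorem hasDerivAt_exp_neg_smul (X : V →L[ℝ] V) :
    HasDerivAt (fun t : ℝ => NormedSpace.exp (-(t • X))) (-X) 0 := by
  simpa using hasDerivAt_exp_smul (-X)

/-- The Lie algebra of a closed linear group, as a linear subspace of `End V`. -/
def lieSubmodule (G : Subgroup (V →L[ℝ] V)ˣ) (hG : IsClosed (G : Set (V →L[ℝ] V)ˣ)) :
    Submodule ℝ (V →L[ℝ] V) where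
  carrier := lieAlgebraOf G
  zero_mem' := fun t => ⟨1, G.one_mem, by simp⟩
  add_mem' := by
    intro X Y hX hY
    refine mem_lieAlgebraOf_of_hasDerivAt hG
      (γ := fun t => NormedSpace.exp (t • X) * NormedSpace.exp (t • Y)) (by simp) ?_ ?_
    · refine Eventually.of_forall fun t => ?_
      exact ⟨_, G.mul_mem (mem_lieAlgebraOf_iff.1 hX t) (mem_lieAlgebraOf_iff.1 hY t), rfl⟩
    · simpa using (hasDerivAt_exp_smul X).fun_mul (hasDerivAt_exp_smul Y)
  smul_mem' := fun c X hX t => by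
    rw [smul_smul]
    exact hX (t * c)

variable {G : Subgroup (V →L[ℝ] V)ˣ}

theorem expUnit_mem {X : V →L[ℝ] V} (h : X ∈ lieAlgebraOf G) : expUnit X ∈ G := by
  simpa using mem_lieAlgebraOf_iff.1 h 1

theorem conj_mem_lieAlgebraOf {a : (V →L[ℝ] V)ˣ} (ha : a ∈ G) {X : V →L[ℝ] V}
    (hX : X ∈ lieAlgebraOf G) :
    (a : V →L[ℝ] V) * X * ((a⁻¹ : (V →L[ℝ] V)ˣ) : V →L[ℝ] V) ∈ lieAlgebraOf G := by
  refine mem_lieAlgebraOf_iff.2 fun t => ?_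
  have : expUnit (t • ((a : V →L[ℝ] V) * X * ((a⁻¹ : (V →L[ℝ] V)ˣ) : V →L[ℝ] V))) =
      a * expUnit (t • X) * a⁻¹ := by
    ext1
    rw [coe_expUnit, ← smul_mul_assoc, ← mul_smul_comm, NormedSpace.exp_units_conj]
    rfl
  rw [this]
  exact G.mul_mem (G.mul_mem ha (mem_lieAlgebraOf_iff.1 hX t)) (G.inv_mem ha)

theorem hasDerivAt_mem_submodule {E : Type*} [NormedAddCommGroup E] [NormedSpace ℝ E]
    [FiniteDimensional ℝ E] (S : Submodule ℝ E) {f : ℝ → E} {f' : E} {t : ℝ}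
    (h : HasDerivAt f f' t) (hf : ∀ᶠ s in 𝓝 t, f s ∈ S) : f' ∈ S := by
  have hcl : IsClosed (S : Set E) := S.closed_of_finiteDimensional
  refine hcl.mem_of_tendsto h.tendsto_slope ?_
  filter_upwards [hf.filter_mono nhdsWithin_le_nhds] with s hs
  rw [slope_def_module]
  exact S.smul_mem _ (S.sub_mem hs hf.self_of_nhds)

theorem bracket_mem_lieAlgebraOf (hG : IsClosed (G : Set (V →L[ℝ] V)ˣ)) {X Y : V →L[ℝ] V}
    (hX : X ∈ lieAlgebraOf G) (hY : Y ∈ lieAlgebraOf G) : X * Y - Y * X ∈ lieAlgebraOf G := by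
  have hd : HasDerivAt (fun t : ℝ => NormedSpace.exp (t • X) * Y * NormedSpace.exp (-(t • X)))
      (X * Y - Y * X) 0 := by
    simpa [sub_eq_add_neg] using
      ((hasDerivAt_exp_smul X).mul_const Y).fun_mul (hasDerivAt_exp_neg_smul X)
  exact hasDerivAt_mem_submodule (lieSubmodule G hG) hd
    (Eventually.of_forall fun t => conj_mem_lieAlgebraOf (mem_lieAlgebraOf_iff.1 hX t) hY)

end Lie

/-! ### Operators at a point of Siegel space -/

section Siegel

variable {V : Type*} [NormedAddCommGroup V] [NormedSpace ℝ V] [FiniteDimensional ℝ V]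
  {ω : LinearMap.BilinForm ℝ V} {x y : V →L[ℝ] V}

/-- The form `g_x = ω(·, x ·)`, an inner product when `x` is a point of the Siegel space. -/
def pointForm (ω : LinearMap.BilinForm ℝ V) (x : V →L[ℝ] V) : LinearMap.BilinForm ℝ V :=
  ω.compl₂ (x : V →ₗ[ℝ] V)

@[simp] theorem pointForm_apply (u v : V) : pointForm ω x u v = ω u (x v) := rfl

theorem apply_apply_of_mul_self (hx : x * x = -1) (v : V) : x (x v) = -v := by
  rw [← mul_apply_eq_comp, hx]
  simp

theorem form_apply_left_of_mem_siegelSpace (hx : x ∈ siegelSpace ω) (u v : V) :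
    ω (x u) v = -ω u (x v) := by
  rw [← hx.2.1 u (x v), apply_apply_of_mul_self hx.1, map_neg, neg_neg]

theorem pointForm_symm (hω : ω.IsAlt) (hx : x ∈ siegelSpace ω) (u v : V) :
    pointForm ω x u v = pointForm ω x v u := by
  rw [pointForm_apply, pointForm_apply, ← neg_neg (ω u (x v)), hω.neg_eq,
    form_apply_left_of_mem_siegelSpace hx, neg_neg]

theorem pointForm_pos (hx : x ∈ siegelSpace ω) (v : V) (hv : v ≠ 0) : 0 < pointForm ω x v v :=
  hx.2.2 v hv

theorem mul_exp_of_anticommute (hx : x * x = -1) {Y : V →L[ℝ] V} (hY : Y * x = -(x * Y)) :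
    x * NormedSpace.exp Y = NormedSpace.exp (-Y) * x := by
  have h := NormedSpace.exp_units_conj (complexStructureUnit x hx) Y
  have h1 : (complexStructureUnit x hx : V →L[ℝ] V) = x := rfl
  have h2 : (((complexStructureUnit x hx)⁻¹ : (V →L[ℝ] V)ˣ) : V →L[ℝ] V) = -x := rfl
  have h3 : x * Y * -x = -Y := by
    rw [mul_neg, mul_assoc, hY, mul_neg, neg_neg, ← mul_assoc, hx, neg_one_mul]
  rw [h1, h2, h3] at h
  rw [h, mul_assoc, neg_mul, hx, neg_neg, mul_one]

theorem exp_mul_eq_conjAction (hx : x * x = -1) {Y : V →L[ℝ] V} (hY : Y * x = -(x * Y)) :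
    NormedSpace.exp Y * x = conjAction (expUnit ((1 / 2 : ℝ) • Y)) x := by
  rw [conjAction, coe_expUnit, coe_expUnit_inv, mul_assoc, mul_exp_of_anticommute hx, neg_neg,
    ← mul_assoc, ← exp_add_smul]
  · norm_num
  · rw [neg_mul, mul_neg, smul_mul_assoc, mul_smul_comm, hY, smul_neg]

theorem exp_smul_of_mul_self (hx : x * x = -1) (t : ℝ) :
    NormedSpace.exp (t • x) = rho x (Complex.exp (t * Complex.I)) := by
  have h := NormedSpace.map_exp (Complex.liftAux x hx).toRingHom
    (Complex.liftAux x hx).toLinearMap.continuous_of_finiteDimensional (t * Complex.I)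
  rw [← Complex.exp_eq_exp_ℂ] at h
  have h1 : (Complex.liftAux x hx).toRingHom (t * Complex.I) = t • x := by
    simp [Complex.liftAux_apply]
  rw [h1] at h
  rw [← h]
  simp [Complex.liftAux_apply, rho, Algebra.algebraMap_eq_smul_one]

theorem complexStructureUnit_mem {G : Subgroup (V →L[ℝ] V)ˣ} (hx : x * x = -1)
    (h : x ∈ lieAlgebraOf G) : complexStructureUnit x hx ∈ G := by
  have h1 := mem_lieAlgebraOf_iff.1 h (Real.pi / 2)
  have h2 : expUnit ((Real.pi / 2) • x) = complexStructureUnit x hx := by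
    ext1
    rw [coe_expUnit, exp_smul_of_mul_self hx]
    push_cast
    rw [Complex.exp_pi_div_two_mul_I]
    simp [rho, complexStructureUnit]
  rwa [h2] at h1

theorem form_skew_of_mem_lieAlgebraOf {X : V →L[ℝ] V}
    (hX : X ∈ lieAlgebraOf (symplecticGroup ω)) (u v : V) : ω (X u) v = -ω u (X v) := by
  let L₁ : (V →L[ℝ] V) →ₗ[ℝ] ℝ :=
    { toFun := fun A => ω (A u) v
      map_add' := fun A B => by simp
      map_smul' := fun c A => by simp }
  let L₂ : (V →L[ℝ] V) →ₗ[ℝ] ℝ :=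
    { toFun := fun A => ω u (A v)
      map_add' := fun A B => by simp
      map_smul' := fun c A => by simp }
  have h1 := L₁.toContinuousLinearMap.hasFDerivAt.comp_hasDerivAt (0 : ℝ) (hasDerivAt_exp_smul X)
  have h2 := L₂.toContinuousLinearMap.hasFDerivAt.comp_hasDerivAt (0 : ℝ)
    (hasDerivAt_exp_neg_smul X)
  have h3 : (L₁.toContinuousLinearMap ∘ fun t : ℝ => NormedSpace.exp (t • X)) =
      (L₂.toContinuousLinearMap ∘ fun t : ℝ => NormedSpace.exp (-(t • X))) := by
    funext t
    change ω (NormedSpace.exp (t • X) u) v = ω u (NormedSpace.exp (-(t • X)) v)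
    have h4 := mem_lieAlgebraOf_iff.1 hX t u (NormedSpace.exp (-(t • X)) v)
    rw [coe_expUnit, ← mul_apply_eq_comp (NormedSpace.exp (t • X)) _ v, exp_mul_exp_neg] at h4
    exact h4
  rw [h3] at h1
  have := h1.unique h2
  simpa [L₁, L₂] using this

theorem form_skew_of_mem_lieAlgebraOf_le {G : Subgroup (V →L[ℝ] V)ˣ} (hG : G ≤ symplecticGroup ω)
    {X : V →L[ℝ] V} (hX : X ∈ lieAlgebraOf G) (u v : V) : ω (X u) v = -ω u (X v) :=
  form_skew_of_mem_lieAlgebraOf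
    (mem_lieAlgebraOf_iff.2 fun t => hG (mem_lieAlgebraOf_iff.1 hX t)) u v

theorem pointForm_apply_of_anticommute {X : V →L[ℝ] V} (hX : ∀ u v, ω (X u) v = -ω u (X v))
    (hXx : X * x = -(x * X)) (u v : V) : pointForm ω x (X u) v = pointForm ω x u (X v) := by
  rw [pointForm_apply, pointForm_apply, hX, ← mul_apply_eq_comp, hXx]
  simp

theorem pointForm_apply_of_commute {X : V →L[ℝ] V} (hX : ∀ u v, ω (X u) v = -ω u (X v))
    (hXx : X * x = x * X) (u v : V) : pointForm ω x (X u) v = -pointForm ω x u (X v) := by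
  rw [pointForm_apply, pointForm_apply, hX, ← mul_apply_eq_comp, hXx]
  simp

theorem isRealDiagonalizable_of_symmetric (hω : ω.IsAlt) (hx : x ∈ siegelSpace ω) {X : V →L[ℝ] V}
    (hX : ∀ u v, pointForm ω x (X u) v = pointForm ω x u (X v)) : IsRealDiagonalizable X := by
  obtain ⟨b, μ, -, hb⟩ := exists_orthonormal_eigenbasis (pointForm ω x) (pointForm_symm hω hx)
    (pointForm_pos hx) (X : V →ₗ[ℝ] V) hX
  exact ⟨b, μ, hb⟩

theorem conjAction_mem_siegelSpace {a : (V →L[ℝ] V)ˣ} (ha : a ∈ symplecticGroup ω)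
    (hx : x ∈ siegelSpace ω) : conjAction a x ∈ siegelSpace ω := by
  have hai := (symplecticGroup ω).inv_mem ha
  refine ⟨?_, fun u v => ?_, fun v hv => ?_⟩
  · simp only [conjAction, mul_assoc, Units.inv_mul_cancel_left]
    rw [← mul_assoc x x, hx.1]
    simp
  · simp only [conjAction, mul_apply_eq_comp]
    rw [ha, hx.2.1, hai]
  · simp only [conjAction, mul_apply_eq_comp]
    rw [← hai, ← mul_apply_eq_comp _ (a : V →L[ℝ] V), Units.inv_mul, one_apply_eq_self]
    refine hx.2.2 _ fun h => hv ?_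
    have h1 := mul_apply_eq_comp (a : V →L[ℝ] V) ((a⁻¹ : (V →L[ℝ] V)ˣ) : V →L[ℝ] V) v
    rwa [Units.mul_inv, h, map_zero] at h1

/-- Two points of the Siegel space differ by the exponential of an operator that is symmetric for
`g_x` and anticommutes with `x`: the logarithm of the positive definite operator `- y x`. -/
theorem exists_exp_mul_eq (hω : ω.IsAlt) (hx : x ∈ siegelSpace ω) (hy : y ∈ siegelSpace ω) :
    ∃ Y : V →L[ℝ] V, IsRealDiagonalizable Y ∧ Y * x = -(x * Y) ∧ NormedSpace.exp Y * x = y := by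
  set B : V →L[ℝ] V := -(y * x) with hB
  have hBs : ∀ u v, pointForm ω x (B u) v = pointForm ω x u (B v) := fun u v => by
    simp only [pointForm_apply, hB, neg_apply, mul_apply_eq_comp, map_neg, LinearMap.neg_apply]
    rw [form_apply_left_of_mem_siegelSpace hy, form_apply_left_of_mem_siegelSpace hx,
      neg_neg]
  have hBp : ∀ v, v ≠ 0 → 0 < pointForm ω x v (B v) := fun v hv => by
    have h0 : x v ≠ 0 := fun h => hv (by
      have := apply_apply_of_mul_self hx.1 v
      rwa [h, map_zero, eq_comm, neg_eq_zero] at this)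
    have := hy.2.2 (x v) h0
    rw [form_apply_left_of_mem_siegelSpace hx] at this
    simpa [hB] using this
  obtain ⟨b, μ, hbo, hb⟩ := exists_orthonormal_eigenbasis (pointForm ω x) (pointForm_symm hω hx)
    (pointForm_pos hx) (B : V →ₗ[ℝ] V) hBs
  have hμ : ∀ i, 0 < μ i := fun i => by
    have h1 := hBp (b i) (b.ne_zero i)
    rw [show B (b i) = μ i • b i from hb i, map_smul, hbo] at h1
    simpa using h1
  set Y : V →L[ℝ] V := (b.constr ℝ fun i => Real.log (μ i) • b i).toContinuousLinearMap with hYdef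
  have hYb : ∀ i, Y (b i) = Real.log (μ i) • b i := fun i => by simp [hYdef]
  have hYd : IsRealDiagonalizable Y := ⟨b, _, hYb⟩
  have hexp : NormedSpace.exp Y = B := by
    refine ContinuousLinearMap.coe_injective (b.ext fun i => ?_)
    have := exp_apply_of_eigenvector (hYb i)
    rw [Real.exp_log (hμ i)] at this
    exact this.trans (hb i).symm
  refine ⟨Y, hYd, ?_, by rw [hexp, hB, neg_mul, mul_assoc, hx.1]; simp⟩
  -- `x Y x⁻¹` and `- Y` are diagonalizable logarithms of the inverse of `- y x`
  have h1 : IsRealDiagonalizable (x * Y * -x) := by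
    let e : V ≃ₗ[ℝ] V := LinearEquiv.ofLinearMap (x : V →ₗ[ℝ] V) ((-x : V →L[ℝ] V) : V →ₗ[ℝ] V)
      (by ext v; simp [apply_apply_of_mul_self hx.1])
      (by ext v; simp [apply_apply_of_mul_self hx.1])
    refine ⟨b.map e, fun i => Real.log (μ i), fun i => ?_⟩
    simp [e, apply_apply_of_mul_self hx.1, hYb]
  have h2 : IsRealDiagonalizable (-Y) := ⟨b, fun i => -Real.log (μ i), fun i => by simp [hYb]⟩
  have h3 : NormedSpace.exp (x * Y * -x) = NormedSpace.exp (-Y) := by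
    have h := NormedSpace.exp_units_conj (complexStructureUnit x hx.1) Y
    have h4 : NormedSpace.exp (x * Y * -x) = x * NormedSpace.exp Y * -x := h
    have h5 : (x * B * -x) * B = 1 := by
      simp only [hB, mul_neg, neg_mul, neg_neg, mul_assoc]
      rw [← mul_assoc x x, hx.1, neg_one_mul, mul_neg, mul_neg, ← mul_assoc y y, hy.1,
        neg_one_mul, mul_neg, neg_neg, hx.1]
      simp
    rw [hexp] at h4
    calc NormedSpace.exp (x * Y * -x)
        = x * B * -x * (NormedSpace.exp Y * NormedSpace.exp (-Y)) := by
          rw [exp_mul_exp_neg, mul_one, h4]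
      _ = NormedSpace.exp (-Y) := by rw [hexp, ← mul_assoc, h5, one_mul]
  have h6 := h1.exp_injective h2 h3
  calc Y * x = -(x * Y * -x) * x := by rw [h6, neg_neg]
    _ = -(x * Y) := by rw [mul_neg, neg_neg, mul_assoc, hx.1]; simp

end Siegel

/-! ### Orbits of polar groups in Siegel space -/

section Polar

variable {V : Type*} [NormedAddCommGroup V] [NormedSpace ℝ V] [FiniteDimensional ℝ V]

/-- A closed subgroup of `Sp(V, ω)` that contains, with a positive definite element
`exp X`, all real powers `exp (t X)`.  Every self-adjoint real algebraic group has this property,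
which is all that the Cartan decomposition needs. -/
structure IsPolarGroup (ω : LinearMap.BilinForm ℝ V) (G : Subgroup (V →L[ℝ] V)ˣ) : Prop where
  le_symplectic : G ≤ symplecticGroup ω
  isClosed : IsClosed (G : Set (V →L[ℝ] V)ˣ)
  mem_lie_of_exp : ∀ X, IsRealDiagonalizable X → expUnit X ∈ G → X ∈ lieAlgebraOf G

/-- A point `x` of the Siegel space that is an infinitesimal element of `G`.  Then `x` is also an
element of `G`, and `G` is stable under the Cartan involution at `x`. -/
structure IsBasePoint (ω : LinearMap.BilinForm ℝ V) (G : Subgroup (V →L[ℝ] V)ˣ) (x : V →L[ℝ] V) :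
    Prop where
  mem_siegel : x ∈ siegelSpace ω
  mem_lie : x ∈ lieAlgebraOf G

variable {ω : LinearMap.BilinForm ℝ V} {G : Subgroup (V →L[ℝ] V)ˣ} {x y : V →L[ℝ] V}

/-- The part of the Lie algebra of `G` that anticommutes with `x`, i.e. the `-1`-eigenspace of the
Cartan involution at `x`.  For a base point `x` it is the tangent space of the orbit of `x`. -/
def IsPolarGroup.tangent (h : IsPolarGroup ω G) (x : V →L[ℝ] V) : Submodule ℝ (V →L[ℝ] V) where
  carrier := {X | X ∈ lieAlgebraOf G ∧ X * x = -(x * X)}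
  zero_mem' := ⟨(lieSubmodule G h.isClosed).zero_mem, by simp⟩
  add_mem' := fun {X Y} hX hY => ⟨(lieSubmodule G h.isClosed).add_mem hX.1 hY.1, by
    rw [add_mul, hX.2, hY.2, mul_add, neg_add]⟩
  smul_mem' := fun c X hX => ⟨(lieSubmodule G h.isClosed).smul_mem c hX.1, by
    rw [smul_mul_assoc, hX.2, mul_smul_comm, smul_neg]⟩

namespace IsBasePoint

theorem mul_self (hx : IsBasePoint ω G x) : x * x = -1 := hx.mem_siegel.1

theorem unit_mem (hx : IsBasePoint ω G x) : complexStructureUnit x hx.mul_self ∈ G :=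
  complexStructureUnit_mem hx.mul_self hx.mem_lie

theorem conj (hx : IsBasePoint ω G x) (hG : IsPolarGroup ω G) {a : (V →L[ℝ] V)ˣ}
    (ha : a ∈ G) : IsBasePoint ω G (conjAction a x) :=
  ⟨conjAction_mem_siegelSpace (hG.le_symplectic ha) hx.mem_siegel,
    conj_mem_lieAlgebraOf ha hx.mem_lie⟩

theorem of_mem_orbit (hx : IsBasePoint ω G x) (hG : IsPolarGroup ω G) (hy : y ∈ orbit G x) :
    IsBasePoint ω G y := by
  obtain ⟨a, ha, rfl⟩ := hy
  exact hx.conj hG ha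

/-- Up to sign, `X ↦ x X x` is the Cartan involution at `x`. -/
theorem mul_mul_mem_lie (hx : IsBasePoint ω G x) (hG : IsPolarGroup ω G) {X : V →L[ℝ] V}
    (hX : X ∈ lieAlgebraOf G) : x * X * x ∈ lieAlgebraOf G := by
  have h1 : x * X * -x ∈ lieAlgebraOf G := conj_mem_lieAlgebraOf hx.unit_mem hX
  have h2 := (lieSubmodule G hG.isClosed).neg_mem h1
  rwa [mul_neg, neg_neg] at h2

/-- The tangent space is a complex subspace, because `[x, X] = 2 x X` when `X` anticommutes with
`x`. -/
theorem mul_mem_tangent (hx : IsBasePoint ω G x) (hG : IsPolarGroup ω G) {X : V →L[ℝ] V}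
    (hX : X ∈ hG.tangent x) : x * X ∈ hG.tangent x := by
  refine ⟨?_, by rw [mul_assoc, hX.2, mul_neg]⟩
  have h1 := bracket_mem_lieAlgebraOf hG.isClosed hx.mem_lie hX.1
  have h2 := (lieSubmodule G hG.isClosed).smul_mem (1 / 2 : ℝ) h1
  rw [hX.2, sub_neg_eq_add, ← two_smul ℝ, smul_smul] at h2
  norm_num at h2
  exact h2

theorem tangentialPart_mem (hx : IsBasePoint ω G x) (hG : IsPolarGroup ω G) {X : V →L[ℝ] V}
    (hX : X ∈ lieAlgebraOf G) : (1 / 2 : ℝ) • (X + x * X * x) ∈ hG.tangent x := by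
  refine (hG.tangent x).smul_mem _ ⟨?_, ?_⟩
  · exact (lieSubmodule G hG.isClosed).add_mem hX (hx.mul_mul_mem_lie hG hX)
  · rw [add_mul, mul_assoc _ x x, mul_add, ← mul_assoc x (x * X) x, ← mul_assoc x x X, hx.mul_self]
    noncomm_ring

theorem isRealDiagonalizable (hx : IsBasePoint ω G x) (hG : IsPolarGroup ω G) (hω : ω.IsAlt)
    {X : V →L[ℝ] V} (hX : X ∈ hG.tangent x) : IsRealDiagonalizable X :=
  isRealDiagonalizable_of_symmetric hω hx.mem_siegel (pointForm_apply_of_anticommute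
    (form_skew_of_mem_lieAlgebraOf_le hG.le_symplectic hX.1) hX.2)

theorem exp_mul_mem_orbit (hx : IsBasePoint ω G x) (hG : IsPolarGroup ω G) {Y : V →L[ℝ] V}
    (hY : Y ∈ hG.tangent x) : NormedSpace.exp Y * x ∈ orbit G x :=
  ⟨_, mem_lieAlgebraOf_iff.1 hY.1 (1 / 2), (exp_mul_eq_conjAction hx.mul_self hY.2).symm⟩

/-- A point `y` of the Siegel space that belongs to the group `G` is `exp Y · x` with `Y` in the
tangent space: the logarithm of `- y x ∈ G` belongs to the Lie algebra. -/
theorem exists_tangent_of_unit_mem (hx : IsBasePoint ω G x) (hG : IsPolarGroup ω G)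
    (hω : ω.IsAlt) (hy : y ∈ siegelSpace ω) (hyG : complexStructureUnit y hy.1 ∈ G) :
    ∃ Y ∈ hG.tangent x, NormedSpace.exp Y * x = y := by
  obtain ⟨Y, hYd, hYx, hY⟩ := exists_exp_mul_eq hω hx.mem_siegel hy
  refine ⟨Y, ⟨hG.mem_lie_of_exp Y hYd ?_, hYx⟩, hY⟩
  have : expUnit Y = complexStructureUnit y hy.1 * (complexStructureUnit x hx.mul_self)⁻¹ := by
    rw [eq_mul_inv_iff_mul_eq]
    exact Units.ext hY
  rw [this]
  exact G.mul_mem hyG (G.inv_mem hx.unit_mem)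

/-- The Cartan decomposition, on the level of orbits. -/
theorem mem_orbit_iff (hx : IsBasePoint ω G x) (hG : IsPolarGroup ω G) (hω : ω.IsAlt) :
    y ∈ orbit G x ↔ ∃ Y ∈ hG.tangent x, NormedSpace.exp Y * x = y := by
  refine ⟨fun hy => ?_, ?_⟩
  · have h := hx.of_mem_orbit hG hy
    exact hx.exists_tangent_of_unit_mem hG hω h.mem_siegel h.unit_mem
  · rintro ⟨Y, hY, rfl⟩
    exact hx.exp_mul_mem_orbit hG hY

end IsBasePoint

theorem conjAction_mul (a b : (V →L[ℝ] V)ˣ) (x : V →L[ℝ] V) :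
    conjAction (a * b) x = conjAction a (conjAction b x) := by
  simp only [conjAction, mul_inv_rev, Units.val_mul, mul_assoc]

theorem mem_orbit_self : x ∈ orbit G x := ⟨1, G.one_mem, by simp [conjAction]⟩

theorem conjAction_mem_orbit {a : (V →L[ℝ] V)ˣ} (ha : a ∈ G) (hy : y ∈ orbit G x) :
    conjAction a y ∈ orbit G x := by
  obtain ⟨b, hb, rfl⟩ := hy
  exact ⟨a * b, G.mul_mem ha hb, conjAction_mul a b x⟩

theorem orbit_eq_of_mem (hy : y ∈ orbit G x) : orbit G y = orbit G x := by
  obtain ⟨b, hb, rfl⟩ := hy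
  ext z
  constructor
  · rintro ⟨a, ha, rfl⟩
    exact conjAction_mem_orbit ha ⟨b, hb, rfl⟩
  · rintro ⟨a, ha, rfl⟩
    refine ⟨a * b⁻¹, G.mul_mem ha (G.inv_mem hb), ?_⟩
    rw [← conjAction_mul, inv_mul_cancel_right]

/-- The symplectic group acts transitively on the Siegel space. -/
theorem siegelSpace_eq_orbit (hω : ω.IsAlt) (hS : IsPolarGroup ω (symplecticGroup ω))
    (hx : IsBasePoint ω (symplecticGroup ω) x) : siegelSpace ω = orbit (symplecticGroup ω) x := by
  ext y
  refine ⟨fun hy => ?_, fun hy => (hx.of_mem_orbit hS hy).mem_siegel⟩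
  obtain ⟨Y, hY, rfl⟩ := hx.exists_tangent_of_unit_mem hS hω hy hy.2.1
  exact hx.exp_mul_mem_orbit hS hY

theorem anticommute_of_hasDerivAt {γ : ℝ → V →L[ℝ] V} {v : V →L[ℝ] V} {t : ℝ}
    (hγ : ∀ᶠ s in 𝓝 t, γ s * γ s = -1) (hd : HasDerivAt γ v t) : v * γ t = -(γ t * v) := by
  have h1 : HasDerivAt (fun s => γ s * γ s) (v * γ t + γ t * v) t := hd.fun_mul hd
  have h2 : HasDerivAt (fun s => γ s * γ s) 0 t :=
    (hasDerivAt_const t (-1 : V →L[ℝ] V)).congr_of_eventuallyEq hγ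
  exact eq_neg_of_add_eq_zero_left (h1.unique h2)

/-- The tangent space of an orbit.  The orbit is contained in `G`, so that a curve `γ` in the orbit
through `x` gives the curve `- γ x` in `G` through `1`. -/
theorem tangentSpaceAt_orbit_self (hG : IsPolarGroup ω G) (hx : IsBasePoint ω G x) :
    tangentSpaceAt (orbit G x) x = hG.tangent x := by
  ext v
  constructor
  · rintro ⟨γ, h0, hγ, hd⟩
    have hv : v * x = -(x * v) := by
      have := anticommute_of_hasDerivAt (hγ.mono fun t ht => (hx.of_mem_orbit hG ht).mul_self) hd
      rwa [h0] at this
    have h1 : v * -x ∈ lieAlgebraOf G := by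
      refine mem_lieAlgebraOf_of_hasDerivAt hG.isClosed (γ := fun t => γ t * -x) ?_ ?_
        (hd.mul_const (-x))
      · simp [h0, hx.mul_self]
      · filter_upwards [hγ] with t ht
        exact ⟨_, G.mul_mem (hx.of_mem_orbit hG ht).unit_mem (G.inv_mem hx.unit_mem), rfl⟩
    have h2 : v * -x ∈ hG.tangent x := ⟨h1, by
      rw [mul_neg, neg_mul, hv, neg_mul, mul_neg, neg_neg, mul_assoc, hv, mul_neg, neg_neg]⟩
    have h3 := hx.mul_mem_tangent hG h2
    have h4 : x * (v * -x) = -v := by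
      rw [mul_neg, hv, neg_neg, ← mul_assoc, hx.mul_self, neg_one_mul]
    rw [h4] at h3
    simpa using (hG.tangent x).neg_mem h3
  · intro hv
    have hA : x * v ∈ hG.tangent x := hx.mul_mem_tangent hG hv
    refine ⟨fun t => NormedSpace.exp (t • (x * v)) * x, by simp, ?_, ?_⟩
    · exact Eventually.of_forall fun t =>
        hx.exp_mul_mem_orbit hG ((hG.tangent x).smul_mem t hA)
    · have := (hasDerivAt_exp_smul (x * v)).mul_const x
      rwa [mul_assoc, hv.2, mul_neg, ← mul_assoc, hx.mul_self, neg_one_mul, neg_neg] at this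

theorem tangentSpaceAt_orbit (hG : IsPolarGroup ω G) (hx : IsBasePoint ω G x)
    (hy : y ∈ orbit G x) : tangentSpaceAt (orbit G x) y = hG.tangent y := by
  rw [← orbit_eq_of_mem hy]
  exact tangentSpaceAt_orbit_self hG (hx.of_mem_orbit hG hy)

/-! ### The trace form -/

theorem siegelForm_apply (X Y : V →L[ℝ] V) :
    siegelForm V X Y = LinearMap.trace ℝ V ((X * Y : V →L[ℝ] V) : V →ₗ[ℝ] V) := rfl

theorem siegelForm_comm (X Y : V →L[ℝ] V) : siegelForm V X Y = siegelForm V Y X :=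
  LinearMap.trace_mul_comm ℝ (X : V →ₗ[ℝ] V) (Y : V →ₗ[ℝ] V)

theorem siegelForm_mul_left (X Y Z : V →L[ℝ] V) :
    siegelForm V (X * Y) Z = siegelForm V X (Y * Z) := by
  rw [siegelForm_apply, siegelForm_apply, mul_assoc]

theorem siegelForm_conj (hx : x * x = -1) (X Y : V →L[ℝ] V) :
    siegelForm V (x * X * x) (x * Y * x) = siegelForm V X Y := by
  have h : siegelForm V (x * X * x) (x * Y * x) = siegelForm V x (X * (x * x) * Y * x) := by
    simp only [siegelForm_apply, mul_assoc]
  rw [h, hx, siegelForm_comm, siegelForm_mul_left, hx, mul_neg, neg_mul, mul_one]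
  simp [siegelForm_apply]

theorem siegelForm_eq_zero_of_commute (hx : x * x = -1) {X Y : V →L[ℝ] V} (hX : X * x = x * X)
    (hY : Y * x = -(x * Y)) : siegelForm V X Y = 0 := by
  have h1 : x * X * x = -X := by rw [mul_assoc, hX, ← mul_assoc, hx, neg_one_mul]
  have h2 : x * Y * x = Y := by
    rw [mul_assoc, hY, mul_neg, ← mul_assoc, hx, neg_one_mul, neg_neg]
  have h := siegelForm_conj hx X Y
  rw [h1, h2, map_neg, LinearMap.neg_apply] at h
  linarith

theorem siegelForm_pos (hω : ω.IsAlt) (hx : x ∈ siegelSpace ω) {X : V →L[ℝ] V}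
    (hX : ∀ u v, ω (X u) v = -ω u (X v)) (hXx : X * x = -(x * X)) (h0 : X ≠ 0) :
    0 < siegelForm V X X :=
  trace_mul_self_pos (pointForm ω x) (pointForm_symm hω hx) (pointForm_pos hx) X
    (pointForm_apply_of_anticommute hX hXx) fun h => h0 (ContinuousLinearMap.coe_injective h)

theorem siegelForm_nonpos_of_commute (hω : ω.IsAlt) (hx : x ∈ siegelSpace ω) {X : V →L[ℝ] V}
    (hX : ∀ u v, ω (X u) v = -ω u (X v)) (hXx : X * x = x * X) : siegelForm V X X ≤ 0 :=
  trace_mul_self_nonpos (pointForm ω x) (pointForm_symm hω hx) (pointForm_pos hx) X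
    (pointForm_apply_of_commute hX hXx)

theorem IsBasePoint.siegelForm_pos (hx : IsBasePoint ω G x) (hG : IsPolarGroup ω G)
    (hω : ω.IsAlt) {X : V →L[ℝ] V} (hX : X ∈ hG.tangent x) (h0 : X ≠ 0) :
    0 < siegelForm V X X :=
  SiegelHodge.siegelForm_pos hω hx.mem_siegel
    (form_skew_of_mem_lieAlgebraOf_le hG.le_symplectic hX.1) hX.2 h0

/-! ### Tangential parts and geodesics -/

/-- The tangential part of an element of the Lie algebra.  The formula does not involve the group:
this is why orbits are totally geodesic. -/
theorem isTangentialPart_orbit (hG : IsPolarGroup ω G) (hx : IsBasePoint ω G x)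
    (hy : y ∈ orbit G x) {X : V →L[ℝ] V} (hX : X ∈ lieAlgebraOf G) :
    IsTangentialPart (siegelForm V) (orbit G x) y X ((1 / 2 : ℝ) • (X + y * X * y)) := by
  have hyb := hx.of_mem_orbit hG hy
  rw [IsTangentialPart, tangentSpaceAt_orbit hG hx hy]
  refine ⟨hyb.tangentialPart_mem hG hX, fun w hw => ?_⟩
  refine siegelForm_eq_zero_of_commute hyb.mul_self ?_ hw.2
  simp only [sub_mul, mul_sub, smul_mul_assoc, mul_smul_comm, add_mul, mul_add]
  rw [mul_assoc _ y y, ← mul_assoc y (y * X) y, ← mul_assoc y y X, hyb.mul_self]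
  simp only [mul_neg, neg_mul, mul_one, one_mul]
  module

theorem eq_of_isTangentialPart_orbit (hω : ω.IsAlt) (hG : IsPolarGroup ω G)
    (hx : IsBasePoint ω G x) (hy : y ∈ orbit G x) {X s t : V →L[ℝ] V}
    (hs : IsTangentialPart (siegelForm V) (orbit G x) y X s)
    (ht : IsTangentialPart (siegelForm V) (orbit G x) y X t) : s = t := by
  have hyb := hx.of_mem_orbit hG hy
  rw [IsTangentialPart, tangentSpaceAt_orbit hG hx hy] at hs ht
  have hst : s - t ∈ hG.tangent y := (hG.tangent y).sub_mem hs.1 ht.1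
  by_contra hne
  have h1 := hyb.siegelForm_pos hG hω hst (sub_ne_zero.2 hne)
  have h2 := hs.2 _ hst
  have h3 := ht.2 _ hst
  have h4 : s - t = (X - t) - (X - s) := by abel
  have h5 : siegelForm V (s - t) (s - t) = 0 := by
    nth_rewrite 1 [h4]
    rw [LinearMap.map_sub₂, h2, h3, sub_zero]
  exact h1.ne' h5

theorem hasDerivAt_mem_tangent (hG : IsPolarGroup ω G) (hx : IsBasePoint ω G x)
    {γ : ℝ → V →L[ℝ] V} {v : V →L[ℝ] V} {t : ℝ} (hγ : ∀ᶠ s in 𝓝 t, γ s ∈ orbit G x)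
    (hd : HasDerivAt γ v t) : v ∈ hG.tangent (γ t) := by
  rw [← SetLike.mem_coe, ← tangentSpaceAt_orbit hG hx hγ.self_of_nhds]
  have h0 : Tendsto (fun s => s + t) (𝓝 0) (𝓝 t) := by
    have : Continuous fun s : ℝ => s + t := by fun_prop
    simpa using this.tendsto 0
  refine ⟨fun s => γ (s + t), by simp, h0.eventually hγ, ?_⟩
  exact HasDerivAt.comp_add_const (f := γ) 0 t (by rwa [zero_add])

/-- The orbit of a smaller polar group is totally geodesic in the orbit of a larger one: the
acceleration of a curve lies in the smaller Lie algebra, where the tangential parts for the two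
groups agree. -/
theorem isGeodesicOn_of_le {H : Subgroup (V →L[ℝ] V)ˣ} (hω : ω.IsAlt) (hG : IsPolarGroup ω G)
    (hx : IsBasePoint ω G x) (hH : IsPolarGroup ω H) (hle : G ≤ H) {γ : ℝ → V →L[ℝ] V} {a b : ℝ}
    (hγ : IsGeodesicOn (siegelForm V) (orbit G x) γ a b) :
    IsGeodesicOn (siegelForm V) (orbit H x) γ a b := by
  obtain ⟨hsm, hmem, hgeo⟩ := hγ
  have hlie : ∀ X, X ∈ lieAlgebraOf G → X ∈ lieAlgebraOf H := fun X hX =>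
    mem_lieAlgebraOf_iff.2 fun t => hle (mem_lieAlgebraOf_iff.1 hX t)
  have hxH : IsBasePoint ω H x := ⟨hx.mem_siegel, hlie _ hx.mem_lie⟩
  have hmemH : ∀ t ∈ Set.Ioo a b, γ t ∈ orbit H x := fun t ht => by
    obtain ⟨c, hc, h⟩ := hmem t ht
    exact ⟨c, hle hc, h⟩
  refine ⟨hsm, hmemH, fun t ht => ?_⟩
  have hnhds : ∀ s ∈ Set.Ioo a b, Set.Ioo a b ∈ 𝓝 s := fun s hs => isOpen_Ioo.mem_nhds hs
  have hd1 : ∀ s ∈ Set.Ioo a b, HasDerivAt γ (deriv γ s) s := fun s hs =>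
    ((hsm.contDiffAt (hnhds s hs)).differentiableAt (by simp)).hasDerivAt
  have hd1G : ∀ s ∈ Set.Ioo a b, deriv γ s ∈ lieSubmodule G hG.isClosed := fun s hs =>
    (hasDerivAt_mem_tangent hG hx (by filter_upwards [hnhds s hs] with r hr using hmem r hr)
      (hd1 s hs)).1
  have hd2 : HasDerivAt (deriv γ) (deriv (deriv γ) t) t := by
    have h1 : ContDiffOn ℝ 1 (deriv γ) (Set.Ioo a b) := hsm.deriv_of_isOpen isOpen_Ioo
      (by rw [one_add_one_eq_two]; exact WithTop.coe_le_coe.2 le_top)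
    exact ((h1.contDiffAt (hnhds t ht)).differentiableAt (by simp)).hasDerivAt
  have hX : deriv (deriv γ) t ∈ lieAlgebraOf G :=
    hasDerivAt_mem_submodule _ hd2 (by filter_upwards [hnhds t ht] with r hr using hd1G r hr)
  have h0 := eq_of_isTangentialPart_orbit hω hG hx (hmem t ht) (hgeo t ht)
    (isTangentialPart_orbit hG hx (hmem t ht) hX)
  rw [h0]
  exact isTangentialPart_orbit hH hxH (hmemH t ht) (hlie _ hX)

end Polar

/-! ### Orbits are submanifolds -/

section Submanifold

variable {V : Type*} [NormedAddCommGroup V] [NormedSpace ℝ V] [FiniteDimensional ℝ V]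
  {ω : LinearMap.BilinForm ℝ V} {G : Subgroup (V →L[ℝ] V)ˣ} {x : V →L[ℝ] V}

theorem contDiff_exp {n : WithTop ℕ∞} :
    ContDiff ℝ n (NormedSpace.exp : (V →L[ℝ] V) → V →L[ℝ] V) :=
  contDiff_iff_contDiffAt.2 fun X => (NormedSpace.exp_analytic (𝕂 := ℝ) X).contDiffAt

/-- On the tangent space at `x`, the logarithm is continuous at `1`: the eigenvalues of `Y` are the
logarithms of those of `exp Y`, and the sum of their squares is the coercive form `tr Y²`. -/
theorem IsBasePoint.exists_norm_lt (hx : IsBasePoint ω G x) (hG : IsPolarGroup ω G)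
    (hω : ω.IsAlt) {ε : ℝ} (hε : 0 < ε) :
    ∃ δ > 0, ∀ Y ∈ hG.tangent x, ‖NormedSpace.exp Y - 1‖ < δ → ‖Y‖ < ε := by
  obtain ⟨C, hC0, hC⟩ := exists_norm_sq_le ((siegelForm V).restrict (hG.tangent x))
    (fun u v => siegelForm_comm _ _)
    (fun v hv => hx.siegelForm_pos hG hω v.2 fun h => hv (Subtype.ext h))
  set D : ℝ := C * finrank ℝ V + 1 with hD
  have hD0 : 0 < D := by positivity
  have hη : 0 < ε / √D := by positivity
  obtain ⟨δ, hδ, hlog⟩ := Metric.continuousAt_iff.1 (Real.continuousAt_log one_ne_zero) _ hη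
  refine ⟨δ, hδ, fun Y hY hlt => ?_⟩
  obtain ⟨b, μ, hbo, hb⟩ := exists_orthonormal_eigenbasis (pointForm ω x)
    (pointForm_symm hω hx.mem_siegel) (pointForm_pos hx.mem_siegel) (Y : V →ₗ[ℝ] V)
    (pointForm_apply_of_anticommute
      (form_skew_of_mem_lieAlgebraOf_le hG.le_symplectic hY.1) hY.2)
  have hμ : ∀ i, |μ i| < ε / √D := fun i => by
    have h1 : (NormedSpace.exp Y - 1) (b i) = (Real.exp (μ i) - 1) • b i := by
      rw [sub_smul, one_smul, ← exp_apply_of_eigenvector (hb i)]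
      simp
    have h2 := (NormedSpace.exp Y - 1).le_opNorm (b i)
    rw [h1, norm_smul] at h2
    have h3 := le_of_mul_le_mul_right h2 (norm_pos_iff.2 (b.ne_zero i))
    have h4 := hlog (x := Real.exp (μ i)) (by rw [Real.dist_eq]; exact h3.trans_lt hlt)
    simpa [Real.dist_eq] using h4
  have htr : siegelForm V Y Y = ∑ i, μ i ^ 2 := by
    have h1 : siegelForm V Y Y = LinearMap.trace ℝ V ((Y : V →ₗ[ℝ] V) * (Y : V →ₗ[ℝ] V)) := rfl
    rw [h1, trace_eq_sum_of_orthonormal b hbo]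
    refine Finset.sum_congr rfl fun i _ => ?_
    rw [End.mul_apply, hb, map_smul, hb, map_smul, map_smul, hbo]
    simp [sq]
  have hsum : siegelForm V Y Y ≤ finrank ℝ V * (ε ^ 2 / D) := by
    rw [htr]
    calc ∑ i, μ i ^ 2 ≤ ∑ _i : Fin (finrank ℝ V), ε ^ 2 / D := by
          refine Finset.sum_le_sum fun i _ => ?_
          rw [← sq_abs]
          calc |μ i| ^ 2 ≤ (ε / √D) ^ 2 := by gcongr; exact (hμ i).le
            _ = ε ^ 2 / D := by rw [div_pow, Real.sq_sqrt hD0.le]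
      _ = _ := by simp
  have h5 : ‖Y‖ ^ 2 ≤ C * siegelForm V Y Y := hC ⟨Y, hY⟩
  have h6 : ‖Y‖ ^ 2 < ε ^ 2 := by
    calc ‖Y‖ ^ 2 ≤ C * (finrank ℝ V * (ε ^ 2 / D)) := h5.trans (by gcongr)
      _ = (C * finrank ℝ V) * (ε ^ 2 / D) := by ring
      _ < D * (ε ^ 2 / D) := by
        have : 0 < ε ^ 2 / D := by positivity
        gcongr
        linarith
      _ = ε ^ 2 := by field_simp
  exact lt_of_pow_lt_pow_left₀ 2 hε.le h6

/-- The inverse of `Y ↦ exp Y · x` straightens the orbit of `x` near `x`. -/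
theorem exists_chart_orbit (hω : ω.IsAlt) (hG : IsPolarGroup ω G) (hx : IsBasePoint ω G x) :
    ∃ (φ : OpenPartialHomeomorph (V →L[ℝ] V) (V →L[ℝ] V)) (W : Submodule ℝ (V →L[ℝ] V)),
      x ∈ φ.source ∧ ContDiffOn ℝ ((⊤ : ℕ∞) : WithTop ℕ∞) φ φ.source ∧
      ContDiffOn ℝ ((⊤ : ℕ∞) : WithTop ℕ∞) φ.symm φ.target ∧
      ∀ y ∈ φ.source, y ∈ orbit G x ↔ φ y ∈ W := by
  set ψ : (V →L[ℝ] V) → V →L[ℝ] V := fun Y => NormedSpace.exp Y * x with hψ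
  have hψs : ∀ n : WithTop ℕ∞, ContDiff ℝ n ψ := fun n => contDiff_exp.mul contDiff_const
  let e : (V →L[ℝ] V) ≃L[ℝ] (V →L[ℝ] V) :=
    (LinearEquiv.ofLinearMap (LinearMap.mulRight ℝ x) (LinearMap.mulRight ℝ (-x))
      (by ext1 Y; simp [mul_assoc, hx.mul_self])
      (by ext1 Y; simp [mul_assoc, hx.mul_self])).toContinuousLinearEquiv
  have hd : HasFDerivAt ψ (e : (V →L[ℝ] V) →L[ℝ] V →L[ℝ] V) 0 := by
    have h1 := (hasFDerivAt_exp_zero (𝕂 := ℝ) (𝔸 := V →L[ℝ] V)).mul_const' x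
    refine h1.congr_fderiv ?_
    ext1 Y
    rfl
  have hψ0 : ψ 0 = x := by simp [hψ]
  set Φ := (hψs ⊤).contDiffAt.toOpenPartialHomeomorph ψ hd (by simp) with hΦ
  have hΦc : ∀ Y, Φ Y = ψ Y := fun Y => rfl
  have h0 : (0 : V →L[ℝ] V) ∈ Φ.source :=
    ContDiffAt.mem_toOpenPartialHomeomorph_source (hψs ⊤).contDiffAt hd (by simp)
  have hxt : x ∈ Φ.target := by
    rw [← hψ0]
    exact Φ.map_source h0
  have hsx : Φ.symm x = 0 := by
    rw [← hψ0]
    exact Φ.left_inv h0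
  -- the inverse is analytic at `x`, hence smooth in a neighbourhood of `x`
  have hsmooth : ∀ᶠ y in 𝓝 x, ContDiffAt ℝ (⊤ : WithTop ℕ∞) Φ.symm y := by
    refine ContDiffAt.eventually ?_ (by simp)
    exact Φ.contDiffAt_symm hxt (by rw [hsx]; exact hd) (by rw [hsx]; exact (hψs ⊤).contDiffAt)
  -- points of the orbit near `x` are `exp Y · x` with `Y` small, so the orbit does not come back
  have hlog : ∀ᶠ y in 𝓝 x, ∀ Y ∈ hG.tangent x, ψ Y = y → Y ∈ Φ.source := by
    obtain ⟨ε, hε, hball⟩ := Metric.isOpen_iff.1 Φ.open_source 0 h0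
    obtain ⟨δ, hδ, hlt⟩ := hx.exists_norm_lt hG hω hε
    have hc : Continuous fun y : V →L[ℝ] V => ‖y * -x - 1‖ := by fun_prop
    have h1 : ∀ᶠ y in 𝓝 x, ‖y * -x - 1‖ < δ := by
      refine hc.continuousAt.eventually_lt continuousAt_const ?_
      simpa [hx.mul_self] using hδ
    filter_upwards [h1] with y hy Y hY hYy
    refine hball (mem_ball_zero_iff.2 (hlt Y hY ?_))
    have : y * -x = NormedSpace.exp Y := by
      rw [← hYy, hψ]
      simp [mul_assoc, hx.mul_self]
    rwa [← this]
  obtain ⟨T, hT, hTo, hxT⟩ := eventually_nhds_iff.1 (hsmooth.and hlog)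
  refine ⟨Φ.symm.restrOpen T hTo, hG.tangent x, ⟨hxt, hxT⟩, ?_, ?_, ?_⟩
  · exact fun y hy => ((hT y hy.2).1.of_le le_top).contDiffWithinAt
  · exact (hψs _).contDiffOn
  · intro y hy
    have hyt : y ∈ Φ.target := hy.1
    change y ∈ orbit G x ↔ Φ.symm y ∈ hG.tangent x
    constructor
    · intro hyo
      obtain ⟨Y, hY, hYy⟩ := (hx.mem_orbit_iff hG hω).1 hyo
      have hYs := (hT y hy.2).2 Y hY hYy
      rw [← hYy]
      have : Φ.symm (Φ Y) = Y := Φ.left_inv hYs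
      rw [hΦc] at this
      change Φ.symm (ψ Y) ∈ _
      rwa [this]
    · intro hY
      have := hx.exp_mul_mem_orbit hG hY
      change ψ _ ∈ _ at this
      rwa [← hΦc, Φ.right_inv hyt] at this

theorem isSmoothSubmanifold_orbit (hω : ω.IsAlt) (hG : IsPolarGroup ω G)
    (hx : IsBasePoint ω G x) : IsSmoothSubmanifold (orbit G x) := by
  intro y hy
  have := exists_chart_orbit hω hG (hx.of_mem_orbit hG hy)
  rwa [orbit_eq_of_mem hy] at this

theorem isRiemannianSubmanifold_orbit (hω : ω.IsAlt) (hG : IsPolarGroup ω G)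
    (hx : IsBasePoint ω G x) : IsRiemannianSubmanifold (siegelForm V) (orbit G x) where
  smooth := isSmoothSubmanifold_orbit hω hG hx
  symm := siegelForm_comm
  pos := fun y hy v hv h0 => by
    rw [tangentSpaceAt_orbit hG hx hy] at hv
    exact (hx.of_mem_orbit hG hy).siegelForm_pos hG hω hv h0

theorem isConnected_orbit (hω : ω.IsAlt) (hG : IsPolarGroup ω G) (hx : IsBasePoint ω G x) :
    IsConnected (orbit G x) := by
  have h : orbit G x = (fun Y => NormedSpace.exp Y * x) '' (hG.tangent x : Set (V →L[ℝ] V)) := by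
    ext y
    exact hx.mem_orbit_iff hG hω
  rw [h]
  refine ((hG.tangent x).convex.isConnected ⟨0, (hG.tangent x).zero_mem⟩).image _ ?_
  exact (NormedSpace.exp_continuous.mul continuous_const).continuousOn

end Submanifold

/-! ### Curvature of orbits -/

section Curvature

variable {V : Type*} [NormedAddCommGroup V] [NormedSpace ℝ V] [FiniteDimensional ℝ V]
  {ω : LinearMap.BilinForm ℝ V} {G : Subgroup (V →L[ℝ] V)ˣ} {x : V →L[ℝ] V}

theorem contDiff_fderiv_apply {f : ℝ × ℝ → V →L[ℝ] V} (hf : ContDiff ℝ ((⊤ : ℕ∞) : WithTop ℕ∞) f)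
    (e : ℝ × ℝ) : ContDiff ℝ ((⊤ : ℕ∞) : WithTop ℕ∞) fun z => fderiv ℝ f z e :=
  (hf.fderiv_right (m := ((⊤ : ℕ∞) : WithTop ℕ∞)) (by simp)).clm_apply contDiff_const

theorem fderiv_mul_apply {f g : ℝ × ℝ → V →L[ℝ] V} {z : ℝ × ℝ} (hf : DifferentiableAt ℝ f z)
    (hg : DifferentiableAt ℝ g z) (e : ℝ × ℝ) :
    fderiv ℝ (fun z => f z * g z) z e = fderiv ℝ f z e * g z + f z * fderiv ℝ g z e := by
  rw [fderiv_fun_mul' hf hg]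
  simp [add_comm]

theorem fderiv_fderiv_comm {f : ℝ × ℝ → V →L[ℝ] V} (hf : ContDiff ℝ ((⊤ : ℕ∞) : WithTop ℕ∞) f)
    (z d e : ℝ × ℝ) :
    fderiv ℝ (fun w => fderiv ℝ f w d) z e = fderiv ℝ (fun w => fderiv ℝ f w e) z d := by
  have hd : DifferentiableAt ℝ (fderiv ℝ f) z :=
    ((hf.fderiv_right (m := ((⊤ : ℕ∞) : WithTop ℕ∞)) (by simp)).differentiable (by simp)) z
  have h : ∀ d : ℝ × ℝ, fderiv ℝ (fun w => fderiv ℝ f w d) z = (fderiv ℝ (fderiv ℝ f) z).flip d :=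
    fun d => by
      rw [fderiv_clm_apply hd (differentiableAt_const d)]
      simp
  rw [h, h]
  have hs : IsSymmSndFDerivAt ℝ f z := hf.contDiffAt.isSymmSndFDerivAt (by
    simp only [minSmoothness_of_isRCLikeNormedField]
    exact WithTop.coe_le_coe.2 le_top)
  exact hs e d

theorem fderiv_mem_tangent (hG : IsPolarGroup ω G) (hx : IsBasePoint ω G x)
    {f : ℝ × ℝ → V →L[ℝ] V} (hf : Differentiable ℝ f) (hfm : ∀ z, f z ∈ orbit G x)
    (z e : ℝ × ℝ) : fderiv ℝ f z e ∈ hG.tangent (f z) := by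
  have := hasDerivAt_mem_tangent hG hx (Eventually.of_forall fun t => hfm (z + t • e))
    ((hf z).hasFDerivAt.hasLineDerivAt e)
  simpa using this

theorem fderiv_mem_submodule {S : Submodule ℝ (V →L[ℝ] V)}
    {f : ℝ × ℝ → V →L[ℝ] V} (hf : Differentiable ℝ f) (hfm : ∀ z, f z ∈ S)
    (z e : ℝ × ℝ) : fderiv ℝ f z e ∈ S :=
  hasDerivAt_mem_submodule S ((hf z).hasFDerivAt.hasLineDerivAt e)
    (Eventually.of_forall fun _ => hfm _)

/-- The derivative of the tangential part of a vector field along `f`. -/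
theorem fderiv_tangentialPart {f g : ℝ × ℝ → V →L[ℝ] V} {z : ℝ × ℝ} (hf : DifferentiableAt ℝ f z)
    (hg : DifferentiableAt ℝ g z) (e : ℝ × ℝ) :
    fderiv ℝ (fun z => (1 / 2 : ℝ) • (g z + f z * g z * f z)) z e =
      (1 / 2 : ℝ) • (fderiv ℝ g z e + (fderiv ℝ f z e * g z * f z + f z * fderiv ℝ g z e * f z +
        f z * g z * fderiv ℝ f z e)) := by
  have h1 : DifferentiableAt ℝ (fun z => f z * g z) z := hf.fun_mul hg
  have h2 : DifferentiableAt ℝ (fun z => f z * g z * f z) z := h1.fun_mul hf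
  rw [fderiv_fun_const_smul (hg.fun_add h2), smul_apply, fderiv_fun_add hg h2,
    add_apply, fderiv_mul_apply h1 hf, fderiv_mul_apply hf hg, add_mul]

/-- The trace identity behind the curvature formula.  Here `U`, `W` are the first derivatives of
`f`, and `P`, `Q`, `R` stand for `f_yy`, `f_xy`, `f_xyy`; the third derivative cancels. -/
theorem curvature_trace_identity {J U W P Q : V →L[ℝ] V} (R : V →L[ℝ] V)
    (hU : U * J = -(J * U)) (hW : W * J = -(J * W))
    (hP : P * J + W * W + (W * W + J * P) = 0) (hQ : Q * J + W * U + (U * W + J * Q) = 0) :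
    siegelForm V ((1 / 2 : ℝ) • (R + (U * P * J + J * R * J + J * P * U)) -
      (1 / 2 : ℝ) • (R + (W * Q * J + J * R * J + J * Q * W))) U =
    1 / 4 * siegelForm V (U * W - W * U) (U * W - W * U) := by
  set τ : (V →L[ℝ] V) →ₗ[ℝ] ℝ := (siegelForm V).flip 1 with hτ
  have hB : ∀ X Y, siegelForm V X Y = τ (X * Y) := fun X Y => by
    simp [hτ, siegelForm_apply]
  have hc : ∀ X Y, τ (X * Y) = τ (Y * X) := fun X Y => by
    rw [← hB, ← hB, siegelForm_comm]
  have hUWJ : W * U * J = J * (W * U) := by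
    rw [mul_assoc, hU, mul_neg, ← mul_assoc, hW, neg_mul, neg_neg, mul_assoc]
  have hWUJ : U * W * J = J * (U * W) := by
    rw [mul_assoc, hW, mul_neg, ← mul_assoc, hU, neg_mul, neg_neg, mul_assoc]
  have e1 : τ (U * P * J * U) + τ (J * P * U * U) = -2 * τ (W * W * (U * U)) := by
    have h1 : τ (U * P * J * U) = τ (P * J * (U * U)) := by
      rw [mul_assoc, mul_assoc, hc, ← mul_assoc, mul_assoc, mul_assoc]
    have h2 := congrArg (fun X => τ (X * (U * U))) hP
    simp only [add_mul, map_add, zero_mul, map_zero] at h2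
    rw [h1, mul_assoc (J * P)]
    linarith
  have e2 : τ (W * Q * J * U) + τ (J * Q * W * U) =
      -(1 / 2) * τ ((U * W + W * U) * (U * W + W * U)) := by
    have h1 : τ (W * Q * J * U) = τ (Q * J * (U * W)) := by
      rw [mul_assoc, mul_assoc, hc, mul_assoc, mul_assoc, mul_assoc]
    have h2 : τ (J * Q * W * U) = τ (Q * J * (W * U)) := by
      rw [mul_assoc, mul_assoc, hc, mul_assoc, hUWJ, mul_assoc]
    have h3 : τ (J * Q * (U * W + W * U)) = τ (Q * J * (U * W + W * U)) := by
      rw [mul_assoc, hc, mul_assoc, mul_assoc, add_mul, hUWJ, hWUJ, ← mul_add]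
    have h4 := congrArg (fun X => τ (X * (U * W + W * U))) hQ
    have h5 : Q * J + W * U + (U * W + J * Q) = (U * W + W * U) + Q * J + J * Q := by abel
    simp only [h5] at h4
    rw [add_mul, map_add, add_mul, map_add, h3, zero_mul, map_zero] at h4
    rw [h1, h2, ← map_add, ← mul_add]
    linarith
  have e3 : τ ((U * W + W * U) * (U * W + W * U)) =
      τ ((U * W - W * U) * (U * W - W * U)) + 4 * τ (W * W * (U * U)) := by
    have h1 : τ (U * W * (W * U)) = τ (W * W * (U * U)) := by
      rw [mul_assoc, hc, mul_assoc, mul_assoc, mul_assoc]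
    have h2 : τ (W * U * (U * W)) = τ (W * W * (U * U)) := by
      rw [mul_assoc, hc, mul_assoc, mul_assoc, hc (W * W), mul_assoc]
    simp only [add_mul, mul_add, sub_mul, mul_sub, map_add, map_sub, h1, h2]
    ring
  rw [hB, hB, ← smul_sub, smul_mul_assoc, map_smul, smul_eq_mul]
  have e4 : (R + (U * P * J + J * R * J + J * P * U) - (R + (W * Q * J + J * R * J + J * Q * W))) *
      U = U * P * J * U + J * P * U * U - (W * Q * J * U + J * Q * W * U) := by
    noncomm_ring
  rw [e4, map_sub, map_add, map_add, e1, e2, e3]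
  ring

/-- The curvature of an orbit: `⟨R(U, W) W, U⟩ = ¼ tr [U, W]²`. -/
theorem curvatureValue_eq (hω : ω.IsAlt) (hG : IsPolarGroup ω G) (hx : IsBasePoint ω G x)
    {f : ℝ × ℝ → V →L[ℝ] V} {κ : ℝ} (h : IsCurvatureValue (siegelForm V) (orbit G x) f κ) :
    κ = 1 / 4 * siegelForm V (partialX f 0 * partialY f 0 - partialY f 0 * partialX f 0)
      (partialX f 0 * partialY f 0 - partialY f 0 * partialX f 0) := by
  obtain ⟨hf, hfm, Ayy, Axy, -, -, hyy, hxy, hκ⟩ := h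
  have hfY : ContDiff ℝ ((⊤ : ℕ∞) : WithTop ℕ∞) (partialY f) := contDiff_fderiv_apply hf (0, 1)
  have hfYY : ContDiff ℝ ((⊤ : ℕ∞) : WithTop ℕ∞) (partialY (partialY f)) :=
    contDiff_fderiv_apply hfY (0, 1)
  have hfXY : ContDiff ℝ ((⊤ : ℕ∞) : WithTop ℕ∞) (partialX (partialY f)) :=
    contDiff_fderiv_apply hfY (1, 0)
  have df := hf.differentiable (by simp)
  have dfY := hfY.differentiable (by simp)
  have dfYY := hfYY.differentiable (by simp)
  have dfXY := hfXY.differentiable (by simp)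
  have hlieY : ∀ z, partialY f z ∈ lieSubmodule G hG.isClosed := fun z =>
    (fderiv_mem_tangent hG hx df hfm z (0, 1)).1
  have hAyy : Ayy = fun z => (1 / 2 : ℝ) • (partialY (partialY f) z +
      f z * partialY (partialY f) z * f z) := funext fun z =>
    eq_of_isTangentialPart_orbit hω hG hx (hfm z) (hyy z)
      (isTangentialPart_orbit hG hx (hfm z) (fderiv_mem_submodule dfY hlieY z (0, 1)))
  have hAxy : Axy = fun z => (1 / 2 : ℝ) • (partialX (partialY f) z +
      f z * partialX (partialY f) z * f z) := funext fun z =>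
    eq_of_isTangentialPart_orbit hω hG hx (hfm z) (hxy z)
      (isTangentialPart_orbit hG hx (hfm z) (fderiv_mem_submodule dfY hlieY z (1, 0)))
  have hxA := fderiv_tangentialPart (df 0) (dfYY 0) (1, 0)
  rw [← hAyy] at hxA
  have hyA := fderiv_tangentialPart (df 0) (dfXY 0) (0, 1)
  rw [← hAxy] at hyA
  have hcomm : fderiv ℝ (partialX (partialY f)) 0 (0, 1) =
      fderiv ℝ (partialY (partialY f)) 0 (1, 0) := fderiv_fderiv_comm hfY 0 (1, 0) (0, 1)
  rw [hcomm] at hyA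
  -- the derivatives of the equation `f_y f + f f_y = 0`
  have hrel : (fun z => partialY f z * f z + f z * partialY f z) = fun _ => 0 := by
    funext z
    have h := (fderiv_mem_tangent hG hx df hfm z (0, 1)).2
    change fderiv ℝ f z (0, 1) * f z + f z * fderiv ℝ f z (0, 1) = 0
    rw [h, neg_add_cancel]
  have hrel' : ∀ e, fderiv ℝ (partialY f) 0 e * f 0 + partialY f 0 * fderiv ℝ f 0 e +
      (fderiv ℝ f 0 e * partialY f 0 + f 0 * fderiv ℝ (partialY f) 0 e) = 0 := fun e => by
    rw [← fderiv_mul_apply (dfY 0) (df 0), ← fderiv_mul_apply (df 0) (dfY 0),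
      ← add_apply, ← fderiv_fun_add ((dfY 0).fun_mul (df 0))
        ((df 0).fun_mul (dfY 0)), hrel]
    simp
  rw [hκ, partialX, partialY, hxA, hyA]
  exact curvature_trace_identity _ (fderiv_mem_tangent hG hx df hfm 0 (1, 0)).2
    (fderiv_mem_tangent hG hx df hfm 0 (0, 1)).2 (hrel' (0, 1)) (hrel' (1, 0))

theorem commutator_commute {J U W : V →L[ℝ] V} (hU : U * J = -(J * U)) (hW : W * J = -(J * W)) :
    (U * W - W * U) * J = J * (U * W - W * U) := by
  rw [sub_mul, mul_assoc, hW, mul_assoc, hU, mul_neg, mul_neg, ← mul_assoc, ← mul_assoc, hU, hW]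
  noncomm_ring

theorem curvatureValue_nonpos (hω : ω.IsAlt) (hG : IsPolarGroup ω G) (hx : IsBasePoint ω G x)
    {f : ℝ × ℝ → V →L[ℝ] V} {κ : ℝ} (h : IsCurvatureValue (siegelForm V) (orbit G x) f κ) :
    κ ≤ 0 := by
  rw [curvatureValue_eq hω hG hx h]
  have df := h.1.differentiable (by simp)
  have hU := fderiv_mem_tangent hG hx df h.2.1 0 (1, 0)
  have hW := fderiv_mem_tangent hG hx df h.2.1 0 (0, 1)
  have := siegelForm_nonpos_of_commute hω (hx.of_mem_orbit hG (h.2.1 0)).mem_siegel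
    (form_skew_of_mem_lieAlgebraOf_le hG.le_symplectic
      (bracket_mem_lieAlgebraOf hG.isClosed hU.1 hW.1)) (commutator_commute hU.2 hW.2)
  exact mul_nonpos_of_nonneg_of_nonpos (by norm_num) this

/-- The plane spanned by `u ≠ 0` and `x u` has negative curvature. -/
theorem exists_curvatureValue_neg_self (hω : ω.IsAlt) (hG : IsPolarGroup ω G)
    (hx : IsBasePoint ω G x) {u : V →L[ℝ] V} (hu : u ∈ hG.tangent x) (h0 : u ≠ 0) :
    ∃ (f : ℝ × ℝ → V →L[ℝ] V) (κ : ℝ), IsCurvatureValue (siegelForm V) (orbit G x) f κ ∧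
      f 0 = x ∧ partialX f 0 = u ∧ κ < 0 := by
  -- the coefficients are chosen so that `∂ₓf = x u x = u` and `∂ᵧf = - u x = x u` at the origin
  set f : ℝ × ℝ → V →L[ℝ] V := fun z => NormedSpace.exp (z.1 • (x * u) - z.2 • u) * x with hf
  have hfs : ContDiff ℝ ((⊤ : ℕ∞) : WithTop ℕ∞) f :=
    (contDiff_exp.comp ((contDiff_fst.smul contDiff_const).sub
      (contDiff_snd.smul contDiff_const))).mul contDiff_const
  have hxu := hx.mul_mem_tangent hG hu
  have hfm : ∀ z, f z ∈ orbit G x := fun z => hx.exp_mul_mem_orbit hG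
    ((hG.tangent x).sub_mem ((hG.tangent x).smul_mem _ hxu) ((hG.tangent x).smul_mem _ hu))
  have hf0 : f 0 = x := by simp [hf]
  have df := hfs.differentiable (by simp)
  have hX : partialX f 0 = u := by
    have h1 := ((df 0).hasFDerivAt.hasLineDerivAt (1, 0) : HasDerivAt _ _ _)
    have h2 := (hasDerivAt_exp_smul (x * u)).mul_const x
    rw [mul_assoc, hu.2, mul_neg, ← mul_assoc, hx.mul_self, neg_one_mul, neg_neg] at h2
    refine h1.unique (h2.congr_of_eventuallyEq (Eventually.of_forall fun t => ?_))
    simp [hf]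
  have hY : partialY f 0 = x * u := by
    have h1 := ((df 0).hasFDerivAt.hasLineDerivAt (0, 1) : HasDerivAt _ _ _)
    have h2 := (hasDerivAt_exp_smul (-u)).mul_const x
    rw [neg_mul, hu.2, neg_neg] at h2
    refine h1.unique (h2.congr_of_eventuallyEq (Eventually.of_forall fun t => ?_))
    simp [hf]
  have hfY : ContDiff ℝ ((⊤ : ℕ∞) : WithTop ℕ∞) (partialY f) := contDiff_fderiv_apply hfs (0, 1)
  have hfYY : ContDiff ℝ ((⊤ : ℕ∞) : WithTop ℕ∞) (partialY (partialY f)) :=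
    contDiff_fderiv_apply hfY (0, 1)
  have hfXY : ContDiff ℝ ((⊤ : ℕ∞) : WithTop ℕ∞) (partialX (partialY f)) :=
    contDiff_fderiv_apply hfY (1, 0)
  have hlieY : ∀ z, partialY f z ∈ lieSubmodule G hG.isClosed := fun z =>
    (fderiv_mem_tangent hG hx df hfm z (0, 1)).1
  have dfY := hfY.differentiable (by simp)
  have hcurv : IsCurvatureValue (siegelForm V) (orbit G x) f _ :=
    ⟨hfs, hfm,
      fun z => (1 / 2 : ℝ) • (partialY (partialY f) z + f z * partialY (partialY f) z * f z),
      fun z => (1 / 2 : ℝ) • (partialX (partialY f) z + f z * partialX (partialY f) z * f z),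
      (hfYY.add ((hfs.mul hfYY).mul hfs)).const_smul (1 / 2 : ℝ),
      (hfXY.add ((hfs.mul hfXY).mul hfs)).const_smul (1 / 2 : ℝ),
      fun z => isTangentialPart_orbit hG hx (hfm z) (fderiv_mem_submodule dfY hlieY z (0, 1)),
      fun z => isTangentialPart_orbit hG hx (hfm z) (fderiv_mem_submodule dfY hlieY z (1, 0)),
      rfl⟩
  refine ⟨f, _, hcurv, hf0, hX, ?_⟩
  rw [curvatureValue_eq hω hG hx hcurv, hX, hY]
  have hskew := form_skew_of_mem_lieAlgebraOf_le hG.le_symplectic hu.1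
  have hsym := pointForm_apply_of_anticommute (x := x) hskew hu.2
  have huu : u * u ≠ 0 := fun h => by
    have := hx.siegelForm_pos hG hω hu h0
    rw [siegelForm_apply, h] at this
    simp at this
  have hpos : 0 < siegelForm V (u * u) (u * u) :=
    trace_mul_self_pos (pointForm ω x) (pointForm_symm hω hx.mem_siegel)
      (pointForm_pos hx.mem_siegel) ((u * u : V →L[ℝ] V) : V →ₗ[ℝ] V)
      (fun v w => (hsym (u v) w).trans (hsym v (u w)))
      fun h => huu (ContinuousLinearMap.coe_injective h)
  have hcommutator : u * (x * u) - x * u * u = (-2 : ℝ) • (x * (u * u)) := by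
    rw [← mul_assoc, hu.2, neg_mul, mul_assoc]
    module
  have hxuu : x * (u * u) * (x * (u * u)) = -(u * u * (u * u)) := by
    have h1 : u * u * x = x * (u * u) := by
      rw [mul_assoc, hu.2, mul_neg, ← mul_assoc, hu.2, neg_mul, neg_neg, mul_assoc]
    rw [← mul_assoc (x * (u * u)), mul_assoc x, h1, ← mul_assoc x x, hx.mul_self, neg_one_mul,
      neg_mul]
  rw [hcommutator, map_smul, LinearMap.map_smul₂, siegelForm_apply, hxuu]
  rw [siegelForm_apply] at hpos
  simp only [ContinuousLinearMap.toLinearMap_neg, map_neg, smul_eq_mul]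
  linarith

theorem exists_curvatureValue_neg (hω : ω.IsAlt) (hG : IsPolarGroup ω G)
    (hx : IsBasePoint ω G x) {p u : V →L[ℝ] V} (hp : p ∈ orbit G x)
    (hu : u ∈ tangentSpaceAt (orbit G x) p) (h0 : u ≠ 0) :
    ∃ (f : ℝ × ℝ → V →L[ℝ] V) (κ : ℝ), IsCurvatureValue (siegelForm V) (orbit G x) f κ ∧
      f 0 = p ∧ partialX f 0 = u ∧ κ < 0 := by
  rw [tangentSpaceAt_orbit hG hx hp] at hu
  rw [← orbit_eq_of_mem hp]
  exact exists_curvatureValue_neg_self hω hG (hx.of_mem_orbit hG hp) hu h0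

end Curvature

/-! ### Holomorphic coordinates -/

/-- A real vector space with a complex structure `j` is `ℂᵏ`. -/
theorem exists_linearEquiv_complex {T : Type*} [AddCommGroup T] [Module ℝ T]
    [FiniteDimensional ℝ T] (j : T →ₗ[ℝ] T) (hj : j * j = -1) :
    ∃ (k : ℕ) (e : T ≃ₗ[ℝ] (Fin k → ℂ)), ∀ v, e (j v) = Complex.I • e v := by
  let _ : Module ℂ T := Module.compHom T (Complex.liftAux j hj).toRingHom
  have hsmul : ∀ (z : ℂ) (v : T), z • v = Complex.liftAux j hj z v := fun z v => rfl
  have : IsScalarTower ℝ ℂ T := ⟨fun r z v => by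
    rw [hsmul, hsmul, map_smul, LinearMap.smul_apply]⟩
  have : Module.Finite ℂ T := Module.Finite.of_restrictScalars_finite ℝ ℂ T
  refine ⟨finrank ℂ T, (finBasis ℂ T).equivFun.restrictScalars ℝ, fun v => ?_⟩
  have h : j v = Complex.I • v := by rw [hsmul, Complex.liftAux_apply_I]
  rw [h]
  exact map_smul (finBasis ℂ T).equivFun Complex.I v

section Complex

variable {V : Type*} [NormedAddCommGroup V] [NormedSpace ℝ V] [FiniteDimensional ℝ V]
  {ω : LinearMap.BilinForm ℝ V} {G : Subgroup (V →L[ℝ] V)ˣ} {x y : V →L[ℝ] V}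

/-- The Cayley transform centred at `x`, which realizes the Siegel space as a bounded domain in
the space of operators anticommuting with `x`. -/
def cayley (x y : V →L[ℝ] V) : V →L[ℝ] V := (x - y) * Ring.inverse (x + y)

theorem contDiffAt_cayley (u : (V →L[ℝ] V)ˣ) (hu : (u : V →L[ℝ] V) = x + y) {n : WithTop ℕ∞} :
    ContDiffAt ℝ n (cayley x) y := by
  have h1 : ContDiffAt ℝ n (Ring.inverse : (V →L[ℝ] V) → V →L[ℝ] V) (x + y) := by
    rw [← hu]
    exact contDiffAt_ringInverse ℝ u
  exact (contDiffAt_const.sub contDiffAt_id).mul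
    (h1.comp y (contDiffAt_const.add contDiffAt_id))

theorem fderiv_cayley_apply (u : (V →L[ℝ] V)ˣ) (hu : (u : V →L[ℝ] V) = x + y)
    (X : V →L[ℝ] V) : fderiv ℝ (cayley x) y X =
      (-2 : ℝ) • (x * ((u⁻¹ : (V →L[ℝ] V)ˣ) * X * (u⁻¹ : (V →L[ℝ] V)ˣ))) := by
  have hinv : HasFDerivAt (Ring.inverse : (V →L[ℝ] V) → V →L[ℝ] V)
      (-ContinuousLinearMap.mulLeftRight ℝ (V →L[ℝ] V) ↑u⁻¹ ↑u⁻¹) (x + y) := by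
    rw [← hu]
    exact hasFDerivAt_ringInverse u
  have hadd : HasFDerivAt (fun z : V →L[ℝ] V => x + z) (ContinuousLinearMap.id ℝ _) y :=
    (hasFDerivAt_id y).const_add x
  have hsub : HasFDerivAt (fun z : V →L[ℝ] V => x - z) (-ContinuousLinearMap.id ℝ _) y :=
    (hasFDerivAt_id y).const_sub x
  have h := hsub.fun_mul' (hinv.comp y hadd)
  have hri : Ring.inverse (x + y) = ((u⁻¹ : (V →L[ℝ] V)ˣ) : V →L[ℝ] V) := by
    rw [← hu, Ring.inverse_unit]
  have h2 : fderiv ℝ (cayley x) y X = (x - y) * -(((u⁻¹ : (V →L[ℝ] V)ˣ) : V →L[ℝ] V) * X *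
      ((u⁻¹ : (V →L[ℝ] V)ˣ) : V →L[ℝ] V)) + -X * Ring.inverse (x + y) := by
    have h3 : fderiv ℝ (cayley x) y = _ := h.fderiv
    rw [h3]
    rfl
  have h4 : X * ((u⁻¹ : (V →L[ℝ] V)ˣ) : V →L[ℝ] V) = (x + y) * (((u⁻¹ : (V →L[ℝ] V)ˣ) :
      V →L[ℝ] V) * X * ((u⁻¹ : (V →L[ℝ] V)ˣ) : V →L[ℝ] V)) := by
    rw [← hu, ← mul_assoc, ← mul_assoc, Units.mul_inv, one_mul]
  rw [h2, hri, neg_mul, h4, mul_neg, sub_mul, add_mul]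
  module

/-- The operator `x + y` carries the tangent space at `x` to the tangent space at `y`.  The point is
that `x W y + y W x` belongs to the Lie algebra: if `y = a x a⁻¹` with `a = exp (Y / 2)`,
it is conjugate by `a` to `a W a + a⁻¹ W a⁻¹ = x (a W x a⁻¹ + a⁻¹ W x a)`. -/
theorem IsBasePoint.sandwich_mem_tangent (hx : IsBasePoint ω G x) (hG : IsPolarGroup ω G)
    (hω : ω.IsAlt) (hy : y ∈ orbit G x) {W : V →L[ℝ] V} (hW : W ∈ hG.tangent x) :
    (x + y) * W * (x + y) ∈ hG.tangent y := by
  have hyb := hx.of_mem_orbit hG hy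
  have hxx := hx.mul_self
  have hyy := hyb.mul_self
  have hxS : x * (x + y) = (x + y) * y := by rw [mul_add, add_mul, hxx, hyy, add_comm]
  have hSx : (x + y) * x = y * (x + y) := by rw [mul_add, add_mul, hxx, hyy, add_comm]
  refine ⟨?_, ?_⟩
  swap
  · rw [mul_assoc _ _ y, ← hxS, ← mul_assoc, mul_assoc _ W x, hW.2, mul_neg, neg_mul,
      ← mul_assoc (x + y) x W, hSx, mul_assoc y, mul_assoc y]
  obtain ⟨Y, hY, hYy⟩ := (hx.mem_orbit_iff hG hω).1 hy
  set a : (V →L[ℝ] V)ˣ := expUnit ((1 / 2 : ℝ) • Y) with ha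
  have haG : a ∈ G := mem_lieAlgebraOf_iff.1 hY.1 _
  obtain ⟨A, hA⟩ : ∃ A : V →L[ℝ] V, A = a := ⟨_, rfl⟩
  obtain ⟨B, hB⟩ : ∃ B : V →L[ℝ] V, B = ((a⁻¹ : (V →L[ℝ] V)ˣ) : V →L[ℝ] V) := ⟨_, rfl⟩
  have hAB : A * B = 1 := by rw [hA, hB, Units.mul_inv]
  have hBA : B * A = 1 := by rw [hA, hB, Units.inv_mul]
  have hY2 : ((1 / 2 : ℝ) • Y) * x = -(x * ((1 / 2 : ℝ) • Y)) :=
    ((hG.tangent x).smul_mem (1 / 2 : ℝ) hY).2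
  have hxA : x * A = B * x := by rw [hA, hB]; exact mul_exp_of_anticommute hxx hY2
  have hxB : x * B = A * x := by
    calc x * B = A * (B * x) * B := by rw [← mul_assoc A, hAB, one_mul]
      _ = A * x := by rw [← hxA, mul_assoc, mul_assoc, hAB, mul_one]
  have hyA : y = A * x * B := by
    rw [← hYy, exp_mul_eq_conjAction hxx hY.2, conjAction, hA, hB]
  have hconj : ∀ X, X ∈ lieAlgebraOf G → A * X * B ∈ lieAlgebraOf G := fun X hX => by
    rw [hA, hB]
    exact conj_mem_lieAlgebraOf haG hX
  have hconj' : ∀ X, X ∈ lieAlgebraOf G → B * X * A ∈ lieAlgebraOf G := fun X hX => by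
    have := conj_mem_lieAlgebraOf (G.inv_mem haG) hX
    rwa [inv_inv, ← hA, ← hB] at this
  set L := lieSubmodule G hG.isClosed with hL
  have hWx : W * x ∈ hG.tangent x := by
    rw [hW.2]
    exact (hG.tangent x).neg_mem (hx.mul_mem_tangent hG hW)
  have hxWx : x * W * x = W := by
    rw [mul_assoc, hW.2, mul_neg, ← mul_assoc, hxx, neg_one_mul, neg_neg]
  set Q : V →L[ℝ] V := A * (W * x) * B + B * (W * x) * A with hQ
  have hQx : Q ∈ hG.tangent x := by
    refine ⟨L.add_mem (hconj _ hWx.1) (hconj' _ hWx.1), ?_⟩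
    have e1 : A * (W * x) * B * x = -(x * (B * (W * x) * A)) := by
      have : B * x = x * A := hxA.symm
      calc A * (W * x) * B * x = A * W * (x * x) * A := by
            rw [mul_assoc _ B x, this]; noncomm_ring
        _ = -(A * (x * W * x) * A) := by rw [hxx, hxWx]; noncomm_ring
        _ = -((A * x) * W * x * A) := by noncomm_ring
        _ = _ := by rw [← hxB]; noncomm_ring
    have e2 : B * (W * x) * A * x = -(x * (A * (W * x) * B)) := by
      have : A * x = x * B := hxB.symm
      calc B * (W * x) * A * x = B * W * (x * x) * B := by
            rw [mul_assoc _ A x, this]; noncomm_ring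
        _ = -(B * (x * W * x) * B) := by rw [hxx, hxWx]; noncomm_ring
        _ = -((B * x) * W * x * B) := by noncomm_ring
        _ = _ := by rw [← hxA]; noncomm_ring
    rw [hQ, add_mul, e1, e2, mul_add]
    abel
  have hmix : x * W * y + y * W * x = A * (x * Q) * B := by
    have e1 : x * W * y = W * B * B := by
      have : y = x * B * B := by rw [hyA, hxB]
      rw [this, ← mul_assoc, ← mul_assoc, hxWx]
    have e2 : y * W * x = A * A * W := by
      have : y = A * A * x := by rw [hyA, mul_assoc, hxB, mul_assoc]
      rw [this, mul_assoc (A * A) x, mul_assoc (A * A), hxWx]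
    have e3 : x * (A * (W * x) * B) = B * W * B := by
      calc x * (A * (W * x) * B) = (x * A) * W * x * B := by noncomm_ring
        _ = B * (x * W * x) * B := by rw [hxA]; noncomm_ring
        _ = _ := by rw [hxWx]
    have e4 : x * (B * (W * x) * A) = A * W * A := by
      calc x * (B * (W * x) * A) = (x * B) * W * x * A := by noncomm_ring
        _ = A * (x * W * x) * A := by rw [hxB]; noncomm_ring
        _ = _ := by rw [hxWx]
    rw [e1, e2, hQ, mul_add, e3, e4, mul_add, add_mul]
    congr 1
    · rw [← mul_assoc, ← mul_assoc, hAB, one_mul]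
    · rw [mul_assoc A (A * W * A), mul_assoc (A * W), hAB, mul_one, mul_assoc]
  have hsum : (x + y) * W * (x + y) = W + y * W * y + (x * W * y + y * W * x) := by
    rw [add_mul, add_mul, mul_add, mul_add, hxWx]
    abel
  rw [hsum, hmix]
  exact L.add_mem (L.add_mem hW.1 (hyb.mul_mul_mem_lie hG hW.1))
    (hconj _ (hx.mul_mem_tangent hG hQx).1)

theorem IsBasePoint.inverse_sandwich_mem_tangent (hx : IsBasePoint ω G x)
    (hG : IsPolarGroup ω G) (hω : ω.IsAlt) (hy : y ∈ orbit G x) (u : (V →L[ℝ] V)ˣ)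
    (hu : (u : V →L[ℝ] V) = x + y) {X : V →L[ℝ] V} (hX : X ∈ hG.tangent y) :
    ((u⁻¹ : (V →L[ℝ] V)ˣ) : V →L[ℝ] V) * X * ((u⁻¹ : (V →L[ℝ] V)ˣ) : V →L[ℝ] V) ∈
      hG.tangent x := by
  have hyb := hx.of_mem_orbit hG hy
  have hxy : x ∈ orbit G y := by
    rw [orbit_eq_of_mem hy]
    exact mem_orbit_self
  have hback : ∀ W ∈ hG.tangent y, (u : V →L[ℝ] V) * W * u ∈ hG.tangent x := fun W hW => by
    rw [hu, add_comm]
    exact hyb.sandwich_mem_tangent hG hω hxy hW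
  have hforth : ∀ W ∈ hG.tangent x, (u : V →L[ℝ] V) * W * u ∈ hG.tangent y := fun W hW => by
    rw [hu]
    exact hx.sandwich_mem_tangent hG hω hy hW
  -- going forth and back is an injective endomorphism of the tangent space at `x`
  let F : hG.tangent x →ₗ[ℝ] hG.tangent x :=
    { toFun := fun W => ⟨_, hback _ (hforth W.1 W.2)⟩
      map_add' := fun W W' => Subtype.ext (by simp [mul_add, add_mul])
      map_smul' := fun c W => Subtype.ext (by simp) }
  have hF : Function.Injective F := fun W W' h => by
    have h1 : (u : V →L[ℝ] V) * (u * W.1 * u) * u = u * (u * W'.1 * u) * u :=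
      congrArg Subtype.val h
    simp only [Units.mul_left_inj, Units.mul_right_inj] at h1
    exact Subtype.ext h1
  obtain ⟨W, hW⟩ := LinearMap.injective_iff_surjective.1 hF ⟨_, hback X hX⟩
  have h1 : (u : V →L[ℝ] V) * (u * W.1 * u) * u = u * X * u := congrArg Subtype.val hW
  simp only [Units.mul_left_inj, Units.mul_right_inj] at h1
  rw [← h1]
  simp only [mul_assoc, Units.inv_mul_cancel_left, Units.mul_inv, mul_one]
  exact W.2

theorem exists_coordinates_orbit (hω : ω.IsAlt) (hG : IsPolarGroup ω G)
    (hx : IsBasePoint ω G x) :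
    ∃ (k : ℕ) (φ : (V →L[ℝ] V) → (Fin k → ℂ)) (U : Set (V →L[ℝ] V)), IsOpen U ∧ x ∈ U ∧
      ContDiffOn ℝ ((⊤ : ℕ∞) : WithTop ℕ∞) φ U ∧ ∀ y ∈ orbit G x ∩ U,
        Set.BijOn (fderiv ℝ φ y) (tangentSpaceAt (orbit G x) y) Set.univ ∧
        ∀ v ∈ tangentSpaceAt (orbit G x) y,
          fderiv ℝ φ y (siegelComplexStructure y v) = Complex.I • fderiv ℝ φ y v := by
  let j : hG.tangent x →ₗ[ℝ] hG.tangent x :=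
    { toFun := fun W => ⟨x * W, hx.mul_mem_tangent hG W.2⟩
      map_add' := fun W W' => Subtype.ext (by simp [mul_add])
      map_smul' := fun c W => Subtype.ext (by simp) }
  have hj : j * j = -1 := by
    ext1 W
    refine Subtype.ext ?_
    change x * (x * W.1) = -W.1
    rw [← mul_assoc, hx.mul_self, neg_one_mul]
  obtain ⟨k, e, he⟩ := exists_linearEquiv_complex j hj
  -- coordinates on the tangent space at `x`, extended linearly to all operators
  obtain ⟨L₀, hL₀⟩ := LinearMap.exists_extend (e : hG.tangent x →ₗ[ℝ] (Fin k → ℂ))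
  let L : (V →L[ℝ] V) →L[ℝ] (Fin k → ℂ) := L₀.toContinuousLinearMap
  have hL : ∀ W (hW : W ∈ hG.tangent x), L W = e ⟨W, hW⟩ := fun W hW =>
    LinearMap.congr_fun hL₀ ⟨W, hW⟩
  have hLx : ∀ W ∈ hG.tangent x, L (x * W) = Complex.I • L W := fun W hW => by
    rw [hL _ (hx.mul_mem_tangent hG hW), hL _ hW, ← he]
    rfl
  have hU : IsOpen {y : V →L[ℝ] V | IsUnit (x + y)} :=
    Units.isOpen.preimage (continuous_const.add continuous_id)
  refine ⟨k, fun y => L (cayley x y), {y | IsUnit (x + y)}, hU, ?_, ?_, ?_⟩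
  · have h1 : (x + x) * (-(1 / 2 : ℝ) • x) = 1 := by
      rw [mul_smul_comm, add_mul, hx.mul_self]
      module
    have h2 : (-(1 / 2 : ℝ) • x) * (x + x) = 1 := by
      rw [smul_mul_assoc, mul_add, hx.mul_self]
      module
    exact ⟨⟨_, _, h1, h2⟩, rfl⟩
  · rintro y ⟨u, hu⟩
    exact (L.contDiff.contDiffAt.comp y (contDiffAt_cayley u hu)).contDiffWithinAt
  · rintro y ⟨hy, u, hu⟩
    have hyb := hx.of_mem_orbit hG hy
    have hfd : ∀ X, fderiv ℝ (fun y => L (cayley x y)) y X = L ((-2 : ℝ) • (x *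
        (((u⁻¹ : (V →L[ℝ] V)ˣ) : V →L[ℝ] V) * X * ((u⁻¹ : (V →L[ℝ] V)ˣ) : V →L[ℝ] V)))) :=
      fun X => by
        rw [← fderiv_cayley_apply u hu]
        have h1 : DifferentiableAt ℝ (cayley x) y :=
          (contDiffAt_cayley (n := 1) u hu).differentiableAt (by simp)
        have h2 := (L.hasFDerivAt.comp y h1.hasFDerivAt).fderiv
        exact congrArg (fun T : (V →L[ℝ] V) →L[ℝ] (Fin k → ℂ) => T X) h2
    have hmem := fun X hX => hx.inverse_sandwich_mem_tangent hG hω hy u hu (X := X) hX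
    have hmem2 := fun X hX => (hG.tangent x).smul_mem (-2 : ℝ)
      (hx.mul_mem_tangent hG (hmem X hX))
    rw [tangentSpaceAt_orbit hG hx hy]
    refine ⟨⟨fun _ _ => Set.mem_univ _, ?_, ?_⟩, ?_⟩
    · intro X hX X' hX' h
      rw [hfd, hfd, hL _ (hmem2 X hX), hL _ (hmem2 X' hX')] at h
      have h1 := congrArg Subtype.val (e.injective h)
      have h2 := smul_right_injective _ (by norm_num : (-2 : ℝ) ≠ 0) h1
      have h3 : x * (x * (((u⁻¹ : (V →L[ℝ] V)ˣ) : V →L[ℝ] V) * X *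
          ((u⁻¹ : (V →L[ℝ] V)ˣ) : V →L[ℝ] V))) = x * (x * (((u⁻¹ : (V →L[ℝ] V)ˣ) :
          V →L[ℝ] V) * X' * ((u⁻¹ : (V →L[ℝ] V)ˣ) : V →L[ℝ] V))) := congrArg (x * ·) h2
      rw [← mul_assoc x x, ← mul_assoc x x, hx.mul_self, neg_one_mul, neg_one_mul, neg_inj] at h3
      simpa only [Units.mul_left_inj, Units.mul_right_inj] using h3
    · intro c _
      obtain ⟨W, hW⟩ := e.surjective c
      have hW2 := (hG.tangent x).smul_mem (1 / 2 : ℝ) (hx.mul_mem_tangent hG W.2)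
      refine ⟨(x + y) * ((1 / 2 : ℝ) • (x * W.1)) * (x + y),
        hx.sandwich_mem_tangent hG hω hy hW2, ?_⟩
      rw [hfd, ← hu]
      have h1 : (-2 : ℝ) • (x * (((u⁻¹ : (V →L[ℝ] V)ˣ) : V →L[ℝ] V) *
          (u * ((1 / 2 : ℝ) • (x * W.1)) * u) * ((u⁻¹ : (V →L[ℝ] V)ˣ) : V →L[ℝ] V))) = W.1 := by
        simp only [mul_assoc, Units.inv_mul_cancel_left, Units.mul_inv, mul_one]
        rw [mul_smul_comm, ← mul_assoc, hx.mul_self, neg_one_mul]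
        module
      rw [h1, hL _ W.2, ← hW]
    · intro X hX
      rw [hfd, hfd, siegelComplexStructure]
      have h1 : ((u⁻¹ : (V →L[ℝ] V)ˣ) : V →L[ℝ] V) * (y * X) *
          ((u⁻¹ : (V →L[ℝ] V)ˣ) : V →L[ℝ] V) = x * (((u⁻¹ : (V →L[ℝ] V)ˣ) : V →L[ℝ] V) * X *
          ((u⁻¹ : (V →L[ℝ] V)ˣ) : V →L[ℝ] V)) := by
        have h2 : (u : V →L[ℝ] V) * x = y * u := by
          rw [hu, mul_add, add_mul, hx.mul_self, hyb.mul_self, add_comm]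
        have h3 : ((u⁻¹ : (V →L[ℝ] V)ˣ) : V →L[ℝ] V) * y =
            x * ((u⁻¹ : (V →L[ℝ] V)ˣ) : V →L[ℝ] V) := by
          rw [Units.eq_mul_inv_iff_mul_eq, mul_assoc, ← h2, Units.inv_mul_cancel_left]
        rw [← mul_assoc _ y X, h3]
        simp only [mul_assoc]
      rw [h1, ← mul_smul_comm, hLx _ (hmem2 X hX)]

theorem isComplexManifold_orbit (hω : ω.IsAlt) (hG : IsPolarGroup ω G)
    (hx : IsBasePoint ω G x) : IsComplexManifold siegelComplexStructure (orbit G x) where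
  smooth := isSmoothSubmanifold_orbit hω hG hx
  stable := fun p hp v hv => by
    rw [tangentSpaceAt_orbit hG hx hp] at hv ⊢
    exact (hx.of_mem_orbit hG hp).mul_mem_tangent hG hv
  coordinates := fun p hp => by
    rw [← orbit_eq_of_mem hp]
    exact exists_coordinates_orbit hω hG (hx.of_mem_orbit hG hp)

/-! ### Orbits are Hermitian symmetric -/

/-- The symmetry at `x` is conjugation by `x ∈ G`. -/
theorem exists_symmetry_self (hG : IsPolarGroup ω G) (hx : IsBasePoint ω G x) :
    ∃ s : (V →L[ℝ] V) → V →L[ℝ] V,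
      IsHolomorphicIsometry siegelComplexStructure (siegelForm V) (orbit G x) s ∧
      (∀ y ∈ orbit G x, s (s y) = y) ∧ s x = x ∧ ∀ᶠ y in 𝓝[orbit G x] x, s y = y → y = x := by
  have hxx := hx.mul_self
  let s : (V →L[ℝ] V) →L[ℝ] V →L[ℝ] V :=
    -ContinuousLinearMap.mulLeftRight ℝ (V →L[ℝ] V) x x
  have hs : ∀ y, s y = -(x * y * x) := fun y => rfl
  have hss : ∀ y, s (s y) = y := fun y => by
    rw [hs, hs, mul_neg, neg_mul, neg_neg, mul_assoc x y x, ← mul_assoc x x, hxx, neg_one_mul,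
      neg_mul, mul_assoc, hxx, mul_neg, mul_one, neg_neg]
  have hmaps : Set.MapsTo s (orbit G x) (orbit G x) := fun y hy => by
    have h1 : s y = conjAction (complexStructureUnit x hxx) y := by
      rw [hs, ← mul_neg]
      rfl
    rw [h1]
    exact conjAction_mem_orbit hx.unit_mem hy
  refine ⟨s, ⟨⟨hmaps, ?_, ?_⟩, ?_, ?_, ?_⟩, fun y _ => hss y, ?_, ?_⟩
  · exact fun y _ z _ h => by rw [← hss y, ← hss z, h]
  · exact fun y hy => ⟨s y, hmaps hy, hss y⟩
  · exact fun y _ => s.contDiff.contDiffAt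
  · intro y _ u _ v _
    rw [s.fderiv, hs, hs, map_neg, map_neg, LinearMap.neg_apply, neg_neg, siegelForm_conj hxx]
  · intro y _ v _
    rw [s.fderiv, hs, hs, hs, siegelComplexStructure, siegelComplexStructure, neg_mul_neg]
    have h1 : x * y * x * (x * v * x) = x * y * (x * x) * v * x := by noncomm_ring
    rw [h1, hxx]
    noncomm_ring
  · rw [hs, hxx, neg_one_mul, neg_neg]
  · -- a fixed point `y` commutes with `x`, so `(y - x) (y + x) = y² - x² = 0`
    have hU : ∀ᶠ y in 𝓝 x, IsUnit (y + x) := by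
      have h1 : (x + x) * (-(1 / 2 : ℝ) • x) = 1 := by
        rw [mul_smul_comm, add_mul, hxx]
        module
      have h2 : (-(1 / 2 : ℝ) • x) * (x + x) = 1 := by
        rw [smul_mul_assoc, mul_add, hxx]
        module
      exact (Units.isOpen.preimage (continuous_id.add continuous_const)).mem_nhds
        ⟨⟨_, _, h1, h2⟩, rfl⟩
    filter_upwards [hU.filter_mono nhdsWithin_le_nhds, self_mem_nhdsWithin] with y hy hyo hfix
    have hyy := (hx.of_mem_orbit hG hyo).mul_self
    have hcomm : x * y = y * x := by
      have h1 : x * s y = y * x := by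
        rw [hs, mul_neg, mul_assoc, ← mul_assoc, hxx, neg_one_mul, neg_neg]
      rw [← h1, hfix]
    have h0 : (y - x) * (y + x) = 0 := by
      rw [sub_mul, mul_add, mul_add, hyy, hxx, hcomm]
      abel
    exact sub_eq_zero.1 (hy.mul_left_eq_zero.1 h0)

theorem isHermitianSymmetricSpaceOfNoncompactType_orbit (hω : ω.IsAlt) (hG : IsPolarGroup ω G)
    (hx : IsBasePoint ω G x) :
    IsHermitianSymmetricSpaceOfNoncompactType siegelComplexStructure (siegelForm V)
      (orbit G x) where
  hermitianSymmetric :=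
    { connected := isConnected_orbit hω hG hx
      complex := isComplexManifold_orbit hω hG hx
      riemannian := isRiemannianSubmanifold_orbit hω hG hx
      hermitian := fun p hp u hu v hv => by
        have hpb := hx.of_mem_orbit hG hp
        rw [tangentSpaceAt_orbit hG hx hp] at hu
        have h1 : p * u * (p * v) = u * v := by
          rw [← mul_assoc, mul_assoc p u p, hu.2, mul_neg, ← mul_assoc, hpb.mul_self, neg_one_mul,
            neg_neg]
        rw [siegelForm_apply, siegelForm_apply, siegelComplexStructure, siegelComplexStructure, h1]
      symmetry := fun p hp => by
        rw [← orbit_eq_of_mem hp]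
        exact exists_symmetry_self hG (hx.of_mem_orbit hG hp) }
  nonpos := fun _ _ h => curvatureValue_nonpos hω hG hx h
  no_flat := fun _ hp _ hu h0 => exists_curvatureValue_neg hω hG hx hp hu h0

end Complex

/-! ### Exponential polynomials -/

/-- The value at `t` of the exponential polynomial `∑ c_μ exp (μ t)`, which is encoded as the
element `∑ c_μ [μ]` of the group algebra of `(ℝ, +)`. -/
def expPolyEval (t : ℝ) : AddMonoidAlgebra ℝ ℝ →ₐ[ℝ] ℝ :=
  AddMonoidAlgebra.lift ℝ ℝ ℝ
    { toFun := fun m => Real.exp (m.toAdd * t)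
      map_one' := by simp
      map_mul' := fun m n => by rw [toAdd_mul, add_mul, Real.exp_add] }

theorem expPolyEval_single (t μ c : ℝ) :
    expPolyEval t (AddMonoidAlgebra.single μ c) = c * Real.exp (μ * t) := by
  rw [expPolyEval, AddMonoidAlgebra.lift_single]
  rfl

/-- The character `n ↦ exp (μ n)` of the natural numbers. -/
def natExpChar (μ : ℝ) : Multiplicative ℕ →* ℝ where
  toFun n := Real.exp (μ * (n.toAdd : ℝ))
  map_one' := by simp
  map_mul' m n := by rw [toAdd_mul, Nat.cast_add, mul_add, Real.exp_add]

theorem natExpChar_injective : Function.Injective natExpChar := fun μ ν h => by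
  have h1 := DFunLike.congr_fun h (Multiplicative.ofAdd 1)
  simpa [natExpChar] using h1

/-- An exponential polynomial that vanishes at the natural numbers is zero, by the linear
independence of the characters of `(ℕ, +)`. -/
theorem eq_zero_of_expPolyEval_nat {F : AddMonoidAlgebra ℝ ℝ}
    (h : ∀ n : ℕ, expPolyEval n F = 0) : F = 0 := by
  have hli := (linearIndependent_monoidHom (Multiplicative ℕ) ℝ).comp natExpChar
    natExpChar_injective
  have h0 := linearIndependent_iff.1 hli F.coeff (by
    funext n
    have h1 := h n.toAdd
    rw [expPolyEval, AddMonoidAlgebra.lift_apply] at h1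
    rw [Finsupp.linearCombination_apply, Finsupp.sum, Finset.sum_apply]
    exact h1)
  ext μ
  rw [h0]
  rfl

section Rational

variable {V : Type*} [NormedAddCommGroup V] [NormedSpace ℝ V] [FiniteDimensional ℝ V]

/-! ### Real points of rational algebraic groups -/

/-- A polynomial in the matrix entries that vanishes at the powers `exp (n X)`, `n ∈ ℕ`, of a real
diagonalizable `X` vanishes on the whole one-parameter group. -/
theorem aeval_exp_smul_eq_zero {ι : Type*} [Fintype ι] [DecidableEq ι] (b : Basis ι ℝ V)
    (q : MvPolynomial (ι × ι) ℝ) {X : V →L[ℝ] V} (hX : IsRealDiagonalizable X)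
    (h : ∀ n : ℕ, MvPolynomial.aeval (fun ij : ι × ι => LinearMap.toMatrix b b
      ((NormedSpace.exp ((n : ℝ) • X) : V →L[ℝ] V) : V →ₗ[ℝ] V) ij.1 ij.2) q = 0) (t : ℝ) :
    MvPolynomial.aeval (fun ij : ι × ι => LinearMap.toMatrix b b
      ((NormedSpace.exp (t • X) : V →L[ℝ] V) : V →ₗ[ℝ] V) ij.1 ij.2) q = 0 := by
  obtain ⟨c, μ, hc⟩ := hX
  set F : ι × ι → AddMonoidAlgebra ℝ ℝ := fun ij =>
    ∑ k, AddMonoidAlgebra.single (μ k) (c.repr (b ij.2) k * b.repr (c k) ij.1) with hF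
  have key : ∀ t : ℝ, MvPolynomial.aeval (fun ij : ι × ι => LinearMap.toMatrix b b
      ((NormedSpace.exp (t • X) : V →L[ℝ] V) : V →ₗ[ℝ] V) ij.1 ij.2) q =
      expPolyEval t (MvPolynomial.aeval F q) := fun t => by
    have h0 : expPolyEval t (MvPolynomial.aeval F q) =
        MvPolynomial.aeval (fun ij => expPolyEval t (F ij)) q :=
      MvPolynomial.comp_aeval_apply _ _ _
    rw [h0]
    congr 2
    funext ij
    have hct : ∀ k, NormedSpace.exp (t • X) (c k) = Real.exp (μ k * t) • c k := fun k =>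
      exp_apply_of_eigenvector (by rw [smul_apply, hc, smul_smul, mul_comm])
    have h1 : NormedSpace.exp (t • X) (b ij.2) =
        ∑ k, (c.repr (b ij.2) k * Real.exp (μ k * t)) • c k := by
      conv_lhs => rw [← c.sum_repr (b ij.2)]
      simp only [map_sum, map_smul, hct, smul_smul]
    rw [LinearMap.toMatrix_apply, ContinuousLinearMap.coe_coe, h1, hF]
    simp only [map_sum, map_smul, expPolyEval_single, Finsupp.coe_finsetSum, Finset.sum_apply,
      Finsupp.smul_apply, smul_eq_mul]
    exact Finset.sum_congr rfl fun k _ => by ring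
  have h0 : MvPolynomial.aeval F q = 0 :=
    eq_zero_of_expPolyEval_nat fun n => by rw [← key, h]
  rw [key, h0, map_zero]

variable {Λ : Submodule ℤ V} {H : Subgroup (V →L[ℝ] V)ˣ}

theorem IsRealPointsOfRationalGroup.isClosed (h : IsRealPointsOfRationalGroup Λ H) :
    IsClosed (H : Set (V →L[ℝ] V)ˣ) := by
  obtain ⟨n, b, P, -, -, hH⟩ := h
  have hset : (H : Set (V →L[ℝ] V)ˣ) = ⋂ q ∈ P, {a : (V →L[ℝ] V)ˣ | MvPolynomial.aeval
      (fun ij : Fin n × Fin n =>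
        LinearMap.toMatrix b b ((a : V →L[ℝ] V) : V →ₗ[ℝ] V) ij.1 ij.2) q = 0} := by
    ext a
    simpa using hH a
  rw [hset]
  refine isClosed_biInter fun q _ => isClosed_eq ?_ continuous_const
  have hc : Continuous fun (a : (V →L[ℝ] V)ˣ) (ij : Fin n × Fin n) =>
      LinearMap.toMatrix b b ((a : V →L[ℝ] V) : V →ₗ[ℝ] V) ij.1 ij.2 := by
    refine continuous_pi fun ij => ?_
    let L : (V →L[ℝ] V) →ₗ[ℝ] ℝ :=
      { toFun := fun A => LinearMap.toMatrix b b (A : V →ₗ[ℝ] V) ij.1 ij.2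
        map_add' := fun A B => by simp
        map_smul' := fun c A => by simp }
    exact L.continuous_of_finiteDimensional.comp Units.continuous_val
  exact ((MvPolynomial.continuous_eval (MvPolynomial.map (algebraMap ℚ ℝ) q)).comp hc).congr
    fun a => MvPolynomial.eval_map _ _ _

theorem IsRealPointsOfRationalGroup.mem_lie_of_exp (h : IsRealPointsOfRationalGroup Λ H)
    {X : V →L[ℝ] V} (hX : IsRealDiagonalizable X) (hXH : expUnit X ∈ H) :
    X ∈ lieAlgebraOf H := by
  obtain ⟨n, b, P, -, -, hH⟩ := h
  refine mem_lieAlgebraOf_iff.2 fun t => (hH _).2 fun q hq => ?_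
  rw [← MvPolynomial.aeval_map_algebraMap ℝ, coe_expUnit]
  refine aeval_exp_smul_eq_zero b _ hX (fun m => ?_) t
  rw [MvPolynomial.aeval_map_algebraMap]
  have h1 : NormedSpace.exp ((m : ℝ) • X) = ((expUnit X ^ m : (V →L[ℝ] V)ˣ) : V →L[ℝ] V) := by
    rw [Nat.cast_smul_eq_nsmul, NormedSpace.exp_nsmul, Units.val_pow_eq_pow_val, coe_expUnit]
  rw [h1]
  exact (hH _).1 (H.pow_mem hXH m) q hq

/-- The complex points of the symplectic group of the form with matrix `M`. -/
def complexSymplecticGroup {n : ℕ} (M : Matrix (Fin n) (Fin n) ℂ) :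
    Subgroup (Matrix.GeneralLinearGroup (Fin n) ℂ) where
  carrier := {g | (g : Matrix (Fin n) (Fin n) ℂ).transpose * M * (g : Matrix (Fin n) (Fin n) ℂ) = M}
  one_mem' := by simp
  mul_mem' := by
    intro g h hg hh
    simp only [Set.mem_ofPred_eq, Units.val_mul, Matrix.transpose_mul] at hg hh ⊢
    calc _ = (h : Matrix (Fin n) (Fin n) ℂ).transpose *
          ((g : Matrix (Fin n) (Fin n) ℂ).transpose * M * (g : Matrix (Fin n) (Fin n) ℂ)) *
          (h : Matrix (Fin n) (Fin n) ℂ) := by simp only [Matrix.mul_assoc]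
      _ = M := by rw [hg, hh]
  inv_mem' := by
    intro g hg
    simp only [Set.mem_ofPred_eq] at hg ⊢
    have h1 : (g : Matrix (Fin n) (Fin n) ℂ) * ((g⁻¹ : Matrix.GeneralLinearGroup (Fin n) ℂ) :
        Matrix (Fin n) (Fin n) ℂ) = 1 := Units.mul_inv g
    have h2 := congrArg Matrix.transpose h1
    rw [Matrix.transpose_mul, Matrix.transpose_one] at h2
    conv_lhs => rw [← hg]
    calc _ = (((g⁻¹ : Matrix.GeneralLinearGroup (Fin n) ℂ) :
          Matrix (Fin n) (Fin n) ℂ).transpose * (g : Matrix (Fin n) (Fin n) ℂ).transpose) * M *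
          ((g : Matrix (Fin n) (Fin n) ℂ) * ((g⁻¹ : Matrix.GeneralLinearGroup (Fin n) ℂ) :
            Matrix (Fin n) (Fin n) ℂ)) := by simp only [Matrix.mul_assoc]
      _ = M := by rw [h1, h2, Matrix.one_mul, Matrix.mul_one]

variable {ω : LinearMap.BilinForm ℝ V}

/-- The symplectic group of a form that is integral on `Λ` is defined over `ℚ`. -/
theorem isRealPointsOfRationalGroup_symplecticGroup (Λ : Submodule ℤ V) [DiscreteTopology Λ]
    [IsZLattice ℝ Λ] (hΛ : ∀ x ∈ Λ, ∀ y ∈ Λ, ∃ m : ℤ, ω x y = m) :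
    IsRealPointsOfRationalGroup Λ (symplecticGroup ω) := by
  have : Module.Finite ℤ Λ := ZLattice.module_finite ℝ Λ
  have : Module.Free ℤ Λ := ZLattice.module_free ℝ Λ
  set b := (finBasis ℤ Λ).ofZLatticeBasis ℝ Λ with hb
  have hbΛ : ∀ i, b i ∈ Λ := fun i => by
    rw [hb, Basis.ofZLatticeBasis_apply]
    exact Subtype.mem _
  choose M hM using fun i j => hΛ (b i) (hbΛ i) (b j) (hbΛ j)
  have haeval : ∀ {K : Type} [Field K] [Algebra ℚ K]
      (A : Matrix (Fin (finrank ℤ Λ)) (Fin (finrank ℤ Λ)) K) (i j : Fin (finrank ℤ Λ)),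
      MvPolynomial.aeval (fun ij : Fin (finrank ℤ Λ) × Fin (finrank ℤ Λ) => A ij.1 ij.2)
        (∑ k, ∑ l, MvPolynomial.X (k, i) * MvPolynomial.C (M k l : ℚ) * MvPolynomial.X (l, j) -
          MvPolynomial.C (M i j : ℚ) :
            MvPolynomial (Fin (finrank ℤ Λ) × Fin (finrank ℤ Λ)) ℚ) =
      ∑ k, ∑ l, A k i * (M k l : K) * A l j - (M i j : K) := by
    intro K _ _ A i j
    simp
  refine ⟨finrank ℤ Λ, b, {q | ∃ i j, q = ∑ k, ∑ l, MvPolynomial.X (k, i) *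
    MvPolynomial.C (M k l : ℚ) * MvPolynomial.X (l, j) - MvPolynomial.C (M i j : ℚ)},
    Basis.ofZLatticeBasis_span ℝ Λ _, ⟨complexSymplecticGroup (Matrix.of fun i j => (M i j : ℂ)),
      fun g => ?_⟩, fun a => ?_⟩
  · have h1 : g ∈ complexSymplecticGroup (Matrix.of fun i j => (M i j : ℂ)) ↔
        ∀ i j, ∑ k, ∑ l, g.val k i * (M k l : ℂ) * g.val l j -
          (M i j : ℂ) = 0 := by
      change g.val.transpose * _ * g.val = _ ↔ _
      rw [← Matrix.ext_iff]
      refine forall₂_congr fun i j => ?_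
      rw [sub_eq_zero, Matrix.mul_apply, Finset.sum_comm]
      simp only [Matrix.mul_apply, Matrix.transpose_apply, Matrix.of_apply, Finset.sum_mul]
    rw [h1]
    constructor
    · rintro h q ⟨i, j, rfl⟩
      rw [haeval, h]
    · intro h i j
      rw [← haeval]
      exact h _ ⟨i, j, rfl⟩
  · set A := LinearMap.toMatrix b b ((a : V →L[ℝ] V) : V →ₗ[ℝ] V) with hA
    have hab : ∀ i, (a : V →L[ℝ] V) (b i) = ∑ k, A k i • b k := fun i => by
      conv_lhs => rw [← b.sum_repr ((a : V →L[ℝ] V) (b i))]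
      simp only [hA, LinearMap.toMatrix_apply, ContinuousLinearMap.coe_coe]
    have hωab : ∀ i j, ω ((a : V →L[ℝ] V) (b i)) ((a : V →L[ℝ] V) (b j)) =
        ∑ k, ∑ l, A k i * (M k l : ℝ) * A l j := fun i j => by
      rw [hab, hab]
      simp only [map_sum, map_smul, LinearMap.sum_apply, LinearMap.smul_apply, smul_eq_mul, hM,
        Finset.mul_sum]
      rw [Finset.sum_comm]
      refine Finset.sum_congr rfl fun k _ => Finset.sum_congr rfl fun l _ => by ring
    have h1 : a ∈ symplecticGroup ω ↔ ∀ i j, ω ((a : V →L[ℝ] V) (b i)) ((a : V →L[ℝ] V) (b j)) =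
        ω (b i) (b j) := by
      refine ⟨fun h i j => h _ _, fun h u v => ?_⟩
      have h2 : ω.compl₁₂ ((a : V →L[ℝ] V) : V →ₗ[ℝ] V) ((a : V →L[ℝ] V) : V →ₗ[ℝ] V) = ω :=
        b.ext fun i => b.ext fun j => h i j
      exact LinearMap.congr_fun₂ h2 u v
    rw [h1]
    constructor
    · rintro h q ⟨i, j, rfl⟩
      rw [haeval, ← hωab, h, hM, sub_self]
    · intro h i j
      have := h _ ⟨i, j, rfl⟩
      rw [haeval, ← hωab, ← hM] at this
      exact sub_eq_zero.1 this

theorem isPolarGroup_symplecticGroup (Λ : Submodule ℤ V) [DiscreteTopology Λ]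
    [IsZLattice ℝ Λ] (hΛ : ∀ x ∈ Λ, ∀ y ∈ Λ, ∃ m : ℤ, ω x y = m) :
    IsPolarGroup ω (symplecticGroup ω) :=
  have h := isRealPointsOfRationalGroup_symplecticGroup Λ hΛ
  ⟨le_rfl, h.isClosed, fun _ => h.mem_lie_of_exp⟩

/-! ### The Hodge group -/

variable {J : V →L[ℝ] V}

theorem exists_exp_smul_eq_rho (hJ : J * J = -1) {z : ℂ} (hz : ‖z‖ = 1) :
    ∃ t : ℝ, NormedSpace.exp (t • J) = rho J z := by
  refine ⟨z.arg, ?_⟩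
  rw [exp_smul_of_mul_self hJ]
  congr 1
  have := Complex.norm_mul_exp_arg_mul_I z
  rwa [hz, Complex.ofReal_one, one_mul] at this

theorem mem_lieAlgebraOf_symplecticGroup (hJ : J ∈ siegelSpace ω) :
    J ∈ lieAlgebraOf (symplecticGroup ω) := by
  refine mem_lieAlgebraOf_iff.2 fun t u v => ?_
  rw [coe_expUnit, exp_smul_of_mul_self hJ.1, Complex.exp_mul_I, ← Complex.ofReal_cos,
    ← Complex.ofReal_sin]
  have h1 := form_apply_left_of_mem_siegelSpace hJ u v
  have h2 := hJ.2.1 u v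
  have h3 := Real.sin_sq_add_cos_sq t
  simp only [rho, Complex.add_re, Complex.add_im, Complex.mul_re, Complex.mul_im,
    Complex.ofReal_re, Complex.ofReal_im, Complex.I_re, Complex.I_im, mul_zero, mul_one, sub_zero,
    add_zero, zero_add, add_apply, smul_apply, one_apply_eq_self, map_add, map_smul,
    LinearMap.add_apply, LinearMap.smul_apply, smul_eq_mul]
  rw [h1, h2]
  linear_combination (ω u v) * h3

theorem mem_lieAlgebraOf_hodgeGroup (Λ : Submodule ℤ V) (hJ : J * J = -1) :
    J ∈ lieAlgebraOf (hodgeGroup Λ J) := by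
  refine mem_lieAlgebraOf_iff.2 fun t => Subgroup.mem_sInf.2 fun H hH => ?_
  obtain ⟨a, ha, h⟩ := hH.2 (Complex.exp (t * Complex.I)) (Complex.norm_exp_ofReal_mul_I t)
  rw [← exp_smul_of_mul_self hJ] at h
  rwa [show expUnit (t • J) = a from Units.ext h.symm]

theorem hodgeGroup_le_symplecticGroup (Λ : Submodule ℤ V) [DiscreteTopology Λ]
    [IsZLattice ℝ Λ] (hΛ : ∀ x ∈ Λ, ∀ y ∈ Λ, ∃ m : ℤ, ω x y = m) (hJ : J ∈ siegelSpace ω) :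
    hodgeGroup Λ J ≤ symplecticGroup ω := by
  refine sInf_le ⟨isRealPointsOfRationalGroup_symplecticGroup Λ hΛ, fun z hz => ?_⟩
  obtain ⟨t, ht⟩ := exists_exp_smul_eq_rho hJ.1 hz
  rw [← ht]
  exact mem_lieAlgebraOf_symplecticGroup hJ t

theorem isPolarGroup_hodgeGroup (Λ : Submodule ℤ V) [DiscreteTopology Λ]
    [IsZLattice ℝ Λ] (hΛ : ∀ x ∈ Λ, ∀ y ∈ Λ, ∃ m : ℤ, ω x y = m) (hJ : J ∈ siegelSpace ω) :
    IsPolarGroup ω (hodgeGroup Λ J) where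
  le_symplectic := hodgeGroup_le_symplecticGroup Λ hΛ hJ
  isClosed := by
    rw [hodgeGroup, Subgroup.coe_sInf]
    exact isClosed_biInter fun H hH => hH.1.isClosed
  mem_lie_of_exp := fun X hX hXG => mem_lieAlgebraOf_iff.2 fun t =>
    Subgroup.mem_sInf.2 fun H hH => mem_lieAlgebraOf_iff.1
      (hH.1.mem_lie_of_exp hX (Subgroup.mem_sInf.1 hXG H hH)) t

end Rational

/-! ### Stabilizers are maximal compact -/

section Compact

variable {V : Type*} [NormedAddCommGroup V] [NormedSpace ℝ V] [FiniteDimensional ℝ V]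
  {ω : LinearMap.BilinForm ℝ V} {G : Subgroup (V →L[ℝ] V)ˣ} {x : V →L[ℝ] V}

theorem conjAction_eq_self_iff {a : (V →L[ℝ] V)ˣ} :
    conjAction a x = x ↔ (a : V →L[ℝ] V) * x = x * a := by
  rw [conjAction, Units.mul_inv_eq_iff_eq_mul]

theorem stabilizerIn_eq_inf_centralizer (hx : x * x = -1) :
    stabilizerIn G x = G ⊓ Subgroup.centralizer {complexStructureUnit x hx} := by
  ext a
  rw [Subgroup.mem_inf, Subgroup.mem_centralizer_singleton_iff, Units.ext_iff]
  exact and_congr_right fun _ => conjAction_eq_self_iff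

/-- The isometry group of a positive definite form is compact. -/
theorem isCompact_isometries (g : LinearMap.BilinForm ℝ V) (hs : ∀ u v, g u v = g v u)
    (hp : ∀ v, v ≠ 0 → 0 < g v v) :
    IsCompact {A : V →L[ℝ] V | ∀ u v, g (A u) (A v) = g u v} := by
  obtain ⟨C, hC0, hC⟩ := exists_norm_sq_le g hs hp
  let T : V →L[ℝ] V →L[ℝ] ℝ :=
    ((LinearMap.toContinuousLinearMap : (V →ₗ[ℝ] ℝ) ≃ₗ[ℝ] (V →L[ℝ] ℝ)).toLinearMap ∘ₗ
      g).toContinuousLinearMap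
  have hT : ∀ u v, T u v = g u v := fun u v => rfl
  refine Metric.isCompact_of_isClosed_isBounded ?_ ?_
  · have hset : {A : V →L[ℝ] V | ∀ u v, g (A u) (A v) = g u v} =
        ⋂ u, ⋂ v, {A | T (A u) (A v) = T u v} := by
      ext A
      simp [hT]
    rw [hset]
    refine isClosed_iInter fun u => isClosed_iInter fun v => isClosed_eq ?_ continuous_const
    fun_prop
  · refine (Metric.isBounded_iff_subset_closedBall 0).2 ⟨√(C * ‖T‖), fun A hA => ?_⟩
    rw [mem_closedBall_zero_iff]
    refine A.opNorm_le_bound (Real.sqrt_nonneg _) fun v => ?_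
    refine (pow_le_pow_iff_left₀ (norm_nonneg _) (by positivity) two_ne_zero).1 ?_
    calc ‖A v‖ ^ 2 ≤ C * T v v := by
          rw [hT, ← hA v v]
          exact hC _
      _ ≤ C * (‖T‖ * ‖v‖ * ‖v‖) := by
          gcongr
          exact (le_abs_self _).trans (T.le_opNorm₂ v v)
      _ = (√(C * ‖T‖) * ‖v‖) ^ 2 := by
          rw [mul_pow, Real.sq_sqrt (by positivity)]
          ring

theorem isCompact_stabilizerIn (hω : ω.IsAlt) (hG : IsPolarGroup ω G) (hx : IsBasePoint ω G x) :
    IsCompact (stabilizerIn G x : Set (V →L[ℝ] V)ˣ) := by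
  have hC := isCompact_isometries (pointForm ω x) (pointForm_symm hω hx.mem_siegel)
    (pointForm_pos hx.mem_siegel)
  set S : Set (V →L[ℝ] V) :=
    {A : V →L[ℝ] V | ∀ u v, pointForm ω x (A u) (A v) = pointForm ω x u v} with hS
  have hrange : S ⊆ Set.range (Units.val : (V →L[ℝ] V)ˣ → V →L[ℝ] V) := fun A hA => by
    have hinj : Function.Injective (A : V →ₗ[ℝ] V) := by
      rw [← LinearMap.ker_eq_bot, LinearMap.ker_eq_bot']
      intro v hv
      by_contra h
      have h1 := hA v v
      rw [show A v = 0 from hv, map_zero] at h1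
      exact (pointForm_pos hx.mem_siegel v h).ne h1
    let e : V ≃L[ℝ] V := (LinearEquiv.ofInjectiveEndo (A : V →ₗ[ℝ] V) hinj).toContinuousLinearEquiv
    exact ⟨ContinuousLinearEquiv.toUnit e, rfl⟩
  have hpre : IsCompact ((Units.val : (V →L[ℝ] V)ˣ → V →L[ℝ] V) ⁻¹' S) :=
    (Units.isOpenEmbedding_val.isInducing.isCompact_preimage_iff hrange).2 hC
  refine hpre.of_isClosed_subset ?_ ?_
  · have hset : (stabilizerIn G x : Set (V →L[ℝ] V)ˣ) =
        (G : Set (V →L[ℝ] V)ˣ) ∩ {a | (a : V →L[ℝ] V) * x = x * a} := by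
      ext a
      exact and_congr_right fun _ => conjAction_eq_self_iff
    rw [hset]
    exact hG.isClosed.inter (isClosed_eq (Units.continuous_val.mul continuous_const)
      (continuous_const.mul Units.continuous_val))
  · rintro a ⟨haG, ha⟩ u v
    rw [conjAction_eq_self_iff] at ha
    have h1 : x ((a : V →L[ℝ] V) v) = (a : V →L[ℝ] V) (x v) := by
      rw [← mul_apply_eq_comp, ← ha, mul_apply_eq_comp]
    rw [pointForm_apply, pointForm_apply, h1]
    exact hG.le_symplectic haG _ _

/-- The powers of an element of a compact group are bounded. -/
theorem eigenvalue_le_one_of_mem_compact {K : Subgroup (V →L[ℝ] V)ˣ}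
    (hK : IsCompact (K : Set (V →L[ℝ] V)ˣ)) {a : (V →L[ℝ] V)ˣ} (ha : a ∈ K) {v : V} (hv : v ≠ 0)
    {r : ℝ} (hr : 0 ≤ r) (h : (a : V →L[ℝ] V) v = r • v) : r ≤ 1 := by
  by_contra! hlt
  obtain ⟨R, hR⟩ := (hK.image Units.continuous_val).isBounded.exists_norm_le
  obtain ⟨n, hn⟩ := pow_unbounded_of_one_lt R hlt
  have hpow : ∀ n : ℕ, ((a ^ n : (V →L[ℝ] V)ˣ) : V →L[ℝ] V) v = r ^ n • v := fun n => by
    induction n with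
    | zero => simp
    | succ n ih => rw [pow_succ', Units.val_mul, mul_apply_eq_comp, ih, map_smul, h, smul_smul,
        pow_succ]
  have h1 := hR _ ⟨a ^ n, K.pow_mem ha n, rfl⟩
  have h2 := ((a ^ n : (V →L[ℝ] V)ˣ) : V →L[ℝ] V).le_opNorm v
  rw [hpow, norm_smul, Real.norm_of_nonneg (pow_nonneg hr n)] at h2
  have h3 := le_of_mul_le_mul_right h2 (norm_pos_iff.2 hv)
  linarith

/-- By the polar decomposition, a group between the stabilizer and `G` that is larger than the
stabilizer contains some `exp Y` with `Y ≠ 0` symmetric, whose powers are unbounded. -/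
theorem isMaximalCompactSubgroup_stabilizerIn (hω : ω.IsAlt) (hG : IsPolarGroup ω G)
    (hx : IsBasePoint ω G x) : IsMaximalCompactSubgroup (stabilizerIn G x) G := by
  refine ⟨fun a ha => ha.1, isCompact_stabilizerIn hω hG hx, fun K hKG hK hle => ?_⟩
  refine le_antisymm (fun a ha => ?_) hle
  refine ⟨hKG ha, ?_⟩
  obtain ⟨Y, hY, hYa⟩ := (hx.mem_orbit_iff hG hω).1 ⟨a, hKG ha, rfl⟩
  have hY2 : (1 / 2 : ℝ) • Y ∈ hG.tangent x := (hG.tangent x).smul_mem _ hY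
  -- the polar decomposition of `a` is `a = e (e⁻¹ a)`
  set e : (V →L[ℝ] V)ˣ := expUnit ((1 / 2 : ℝ) • Y) with he
  have heG : e ∈ G := expUnit_mem hY2.1
  have hconj : conjAction e x = conjAction a x := by
    rw [← hYa, exp_mul_eq_conjAction hx.mul_self hY.2]
  have hk : e⁻¹ * a ∈ stabilizerIn G x := by
    refine ⟨G.mul_mem (G.inv_mem heG) (hKG ha), ?_⟩
    rw [conjAction_mul, ← hconj, ← conjAction_mul, inv_mul_cancel]
    simp [conjAction]
  have heK : e ∈ K := by
    have h1 := K.mul_mem ha (K.inv_mem (hle hk))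
    rwa [mul_inv_rev, inv_inv, mul_inv_cancel_left] at h1
  obtain ⟨b, μ, hb⟩ := hx.isRealDiagonalizable hG hω hY2
  have hμ : ∀ i, μ i = 0 := fun i => by
    have h1 := eigenvalue_le_one_of_mem_compact hK heK (b.ne_zero i) (Real.exp_pos _).le
      (exp_apply_of_eigenvector (hb i))
    have h2 := eigenvalue_le_one_of_mem_compact hK (K.inv_mem heK) (b.ne_zero i)
      (Real.exp_pos _).le
      (exp_apply_of_eigenvector (X := -((1 / 2 : ℝ) • Y)) (μ := -μ i) (by
        rw [neg_apply, hb, neg_smul]))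
    rw [Real.exp_le_one_iff] at h1 h2
    linarith
  have hY0 : (1 / 2 : ℝ) • Y = 0 := ContinuousLinearMap.coe_injective (b.ext fun i => by
    rw [ContinuousLinearMap.coe_coe, hb, hμ]
    simp)
  rw [← hconj, he, hY0]
  simp [conjAction]

end Compact

end SiegelHodge

end

theorem mainTheorem3 {V : Type*} [NormedAddCommGroup V] [NormedSpace ℝ V] [FiniteDimensional ℝ V]
    (ω : LinearMap.BilinForm ℝ V) (hω : ω.IsAlt) (hω' : ω.Nondegenerate)
    (Λ : Submodule ℤ V) [DiscreteTopology Λ] [IsZLattice ℝ Λ]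
    (hΛ : ∀ x ∈ Λ, ∀ y ∈ Λ, ∃ m : ℤ, ω x y = m)
    (J : V →L[ℝ] V) (hJ : J ∈ siegelSpace ω) :
    (complexStructureUnit J hJ.1 ∈ hodgeGroup Λ J ∧ J ∈ lieAlgebraOf (hodgeGroup Λ J)) ∧
    (hodgeGroup Λ J ≤ symplecticGroup ω ∧
      (hodgeGroup Λ J).map (MulAut.conj (complexStructureUnit J hJ.1)).toMonoidHom =
        hodgeGroup Λ J) ∧
    (stabilizerIn (hodgeGroup Λ J) J =
        hodgeGroup Λ J ⊓ Subgroup.centralizer {complexStructureUnit J hJ.1} ∧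
      IsMaximalCompactSubgroup (stabilizerIn (hodgeGroup Λ J) J) (hodgeGroup Λ J)) ∧
    (IsComplexSubmanifold siegelComplexStructure (orbit (hodgeGroup Λ J) J) (siegelSpace ω) ∧
      IsTotallyGeodesicSubmanifold (siegelForm V) (orbit (hodgeGroup Λ J) J) (siegelSpace ω) ∧
      IsHermitianSymmetricSpaceOfNoncompactType siegelComplexStructure (siegelForm V)
        (orbit (hodgeGroup Λ J) J)) := by
  have hG := isPolarGroup_hodgeGroup Λ hΛ hJ
  have hS := isPolarGroup_symplecticGroup Λ hΛ
  have hx : IsBasePoint ω (hodgeGroup Λ J) J := ⟨hJ, mem_lieAlgebraOf_hodgeGroup Λ hJ.1⟩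
  have hxS : IsBasePoint ω (symplecticGroup ω) J := ⟨hJ, mem_lieAlgebraOf_symplecticGroup hJ⟩
  have hsub : orbit (hodgeGroup Λ J) J ⊆ siegelSpace ω := fun y hy =>
    (hx.of_mem_orbit hG hy).mem_siegel
  have hN := siegelSpace_eq_orbit hω hS hxS
  refine ⟨⟨hx.unit_mem, hx.mem_lie⟩, ⟨hG.le_symplectic, ?_⟩,
    ⟨stabilizerIn_eq_inf_centralizer hJ.1, isMaximalCompactSubgroup_stabilizerIn hω hG hx⟩,
    ⟨hsub, isComplexManifold_orbit hω hG hx, ?_⟩, ⟨hsub, isRiemannianSubmanifold_orbit hω hG hx,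
      ?_, fun γ a b hγ => ?_⟩, isHermitianSymmetricSpaceOfNoncompactType_orbit hω hG hx⟩
  · ext a
    constructor
    · rintro ⟨b, hb, rfl⟩
      exact Subgroup.mul_mem _ (Subgroup.mul_mem _ hx.unit_mem hb) (Subgroup.inv_mem _ hx.unit_mem)
    · intro ha
      refine ⟨(complexStructureUnit J hJ.1)⁻¹ * a * complexStructureUnit J hJ.1,
        Subgroup.mul_mem _ (Subgroup.mul_mem _ (Subgroup.inv_mem _ hx.unit_mem) ha) hx.unit_mem, ?_⟩
      simp [mul_assoc]
  · rw [hN]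
    exact isComplexManifold_orbit hω hS hxS
  · rw [hN]
    exact isRiemannianSubmanifold_orbit hω hS hxS
  · rw [hN]
    exact isGeodesicOn_of_le hω hG hx hS hG.le_symplectic hγ
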